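/- Let $\Omega\subset\mathbb R^2$ be a bounded domain whose boundary $\gamma=\partial\Omega$ is a simple closed $C^\infty$ curve, parametrized by arc length and oriented counterclockwise, with inner unit normal $n=J\dot\gamma$, where $J$ is the rotation by $\pi/2$. Let $r_0>0$ be the maximal radius of a tubular neighbourhood of $\gamma$, i.e. the supremum of all $\rho>0$ such that $(s,t)\mapsto\gamma(s)+t\,n(s)$ is a diffeomorphism of $\gamma\times(-\rho,\rho)$ onto its image. For a field magnitude $\beta>0$ put $r=1/\beta$. In the magnetic billiard in $\Omega$ a particle moves inside $\Omega$ with unit speed, counterclockwise, along arcs of circles of radius $r$: with initial position $x$ and unit velocity $v$, its position and velocity are $x(t)=x+rJv-rJv(t)$ and $v(t)=R_{\beta t}v$, where $R_\theta$ is the counterclockwise rotation by $\theta$. At the boundary it is reflected by $v\mapsto v-2\langle n,v\rangle n$. For $r<r_0/2$ let $\overline\Omega_+=\{\gamma(s)+t\,n(s):0\le t\le 2r\}$, the closed annulus swept by the arcs that meet $\gamma$. A polynomial-in-momenta integral is a function $\Phi(x,v)=\sum_{k+l\le N}a_{kl}(x)v_1^kv_2^l$, for some $N\ge 0$, on the unit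 tangent vectors $v$ at points $x\in\overline\Omega_+$, with $a_{kl}\in C^\infty(\overline\Omega_+)$ (smooth up to the boundary), such that 1. for every $x\in\gamma$ and every inward unit vector $v$ at $x$ (that is, $\langle n,v\rangle>0$), $\Phi(x(t),v(t))=\Phi(x,v)$ for all $t\ge0$ up to and including the next collision with $\gamma$; 2. $\Phi(x,v)=\Phi(x,v-2\langle n,v\rangle n)$ for every $x\in\gamma$ and every unit vector $v$. Suppose that $\Omega$ is not a round disc. Then for all but finitely many $\beta>0$ with $1/\beta<r_0/2$, the magnetic billiard in $\Omega$ has no polynomial-in-momenta integral that is non-constant as a function on the unit tangent vectors at points of $\overline\Omega_+$. -/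

import Mathlib

open Set Filter Topology
open scoped ContDiff

noncomputable section

namespace MagneticBilliard

/-- `Ω` is a bounded plane domain (the plane is `ℂ` with its real Euclidean structure; the complex
structure `J` is multiplication by `I`) whose boundary is the simple smooth closed curve `γ` of
length `L`, parametrized by arc length and oriented counterclockwise, i.e. so that `J γ'` points
into `Ω`. -/
structure IsTable (Ω : Set ℂ) (γ : ℝ → ℂ) (L : ℝ) : Prop where
  isOpen : IsOpen Ω
  isConnected : IsConnected Ω
  isBounded : Bornology.IsBounded Ω
  length_pos : 0 < L
  smooth : ContDiff ℝ ∞ γ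
  periodic : Function.Periodic γ L
  simple : InjOn γ (Ico 0 L)
  unit_speed : ∀ s, ‖deriv γ s‖ = 1
  frontier_eq : frontier Ω = range γ
  inward : ∀ s, ∀ᶠ t : ℝ in 𝓝[>] 0, γ s + t • (Complex.I * deriv γ s) ∈ Ω

/-- The positive unit normal `n = J γ'` of the curve. -/
def normal (γ : ℝ → ℂ) (s : ℝ) : ℂ := Complex.I * deriv γ s

/-- The normal map `(s, t) ↦ γ(s) + t n(s)`; for fixed `t` it parametrizes the parallel curve
`γ_t`. -/
def normalMap (γ : ℝ → ℂ) (p : ℝ × ℝ) : ℂ := γ p.1 + p.2 • normal γ p.1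

/-- `ρ` is the radius of a tubular neighbourhood of `γ`: the normal map is a diffeomorphism of
`(ℝ / Lℤ) × (-ρ, ρ)` onto its image, i.e. it is injective and a local diffeomorphism there. -/
def IsTubularRadius (γ : ℝ → ℂ) (L ρ : ℝ) : Prop :=
  0 < ρ ∧ InjOn (normalMap γ) (Ico 0 L ×ˢ Ioo (-ρ) ρ) ∧
    ∀ s : ℝ, ∀ t ∈ Ioo (-ρ) ρ, Function.Bijective (fderiv ℝ (normalMap γ) (s, t))

/-- `r₀`, the maximal radius of a tubular neighbourhood of `γ`. -/
def tubularRadius (γ : ℝ → ℂ) (L : ℝ) : ℝ := sSup {ρ : ℝ | IsTubularRadius γ L ρ}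

/-- The Larmor radius for the field magnitude `β`. -/
def larmorRadius (β : ℝ) : ℝ := 1 / β

/-- The velocity at time `t` of the magnetic motion with initial velocity `v`. -/
def velocity (β : ℝ) (v : ℂ) (t : ℝ) : ℂ := Complex.exp ((β * t : ℝ) * Complex.I) * v

/-- The position at time `t` of the magnetic motion with initial position `x` and initial unit
velocity `v`: counterclockwise motion with unit speed along the circle of radius `r = 1 / β`
centred at `x + r J v`. -/
def position (β : ℝ) (x v : ℂ) (t : ℝ) : ℂ :=
  x + larmorRadius β • (Complex.I * v) - larmorRadius β • (Complex.I * velocity β v t)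

/-- The closure of `Ω₊`, the closed annulus between `γ` and the parallel curve `γ_{2r}`. -/
def closedAnnulus (γ : ℝ → ℂ) (β : ℝ) : Set ℂ :=
  normalMap γ '' (univ ×ˢ Icc 0 (2 * larmorRadius β))

/-- `∑_{k + l ≤ N} a_{kl}(x) v₁ᵏ v₂ˡ`. -/
def polyInMomenta (N : ℕ) (a : ℕ → ℕ → ℂ → ℝ) (x v : ℂ) : ℝ :=
  ∑ k ∈ Finset.range (N + 1), ∑ l ∈ Finset.range (N + 1 - k), a k l x * v.re ^ k * v.im ^ l

/-- `Φ` is a polynomial in momenta integral of the magnetic billiard in `Ω`. Only the values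
`Φ x v` with `x` in the closed annulus and `‖v‖ = 1` matter. -/
structure IsPolynomialIntegral (Ω : Set ℂ) (γ : ℝ → ℂ) (β : ℝ) (Φ : ℂ → ℂ → ℝ) : Prop where
  polynomial : ∃ (N : ℕ) (a : ℕ → ℕ → ℂ → ℝ),
    (∀ k l, k + l ≤ N → ContDiffOn ℝ ∞ (a k l) (closedAnnulus γ β)) ∧
    ∀ x ∈ closedAnnulus γ β, ∀ v : ℂ, ‖v‖ = 1 → Φ x v = polyInMomenta N a x v
  /-- Conservation along every arc that starts at the boundary with a unit inward velocity, up to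
  (and including) the next collision. -/
  flow : ∀ (s : ℝ) (v : ℂ), ‖v‖ = 1 → 0 < inner ℝ (normal γ s) v →
    ∀ t : ℝ, 0 ≤ t → (∀ τ ∈ Ioo 0 t, position β (γ s) v τ ∈ Ω) →
      Φ (position β (γ s) v t) (velocity β v t) = Φ (γ s) v
  reflection : ∀ (s : ℝ) (v : ℂ), ‖v‖ = 1 →
    Φ (γ s) (v - (2 * inner ℝ (normal γ s) v) • normal γ s) = Φ (γ s) v

/-- `Φ` is constant on the unit tangent bundle over the closed annulus. -/
def IsConstantOnPhaseSpace (γ : ℝ → ℂ) (β : ℝ) (Φ : ℂ → ℂ → ℝ) : Prop :=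
  ∃ c : ℝ, ∀ x ∈ closedAnnulus γ β, ∀ v : ℂ, ‖v‖ = 1 → Φ x v = c

end MagneticBilliard

end

/-!
Fix `β` with `r = 1 / β < r₀ / 2` and write `n` for the inner normal and `κ` for the curvature of
`γ`.

*The integral is a polynomial of the Larmor centre.* On unit vectors `vᴺ Φ(x, v) = ∑ⱼ Bⱼ(x) vʲ` with
smooth `Bⱼ` (`exists_coeff_polyInMomenta`). Each point of the open annulus between `γ` and `γ_{2r}`
is reached with infinitely many velocities along arcs in `Ω` that start at the boundary
(`IsTubularRadius.infinite_arrivalVelocities`), so the conservation law, a polynomial identity in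
`v`, splits into the equations `∂Bⱼ₋₂ + ∂̄Bⱼ + iβ(j - 1 - N)Bⱼ₋₁ = 0`. They imply that high powers
of `∂` and of `∂̄` annihilate `Bⱼ`, which is therefore a polynomial in `z` and `z̄`. Rotating `v`
about a fixed centre then shows that `Φ(x, v) = P(x + r J v)` for a polynomial `P`
(`IsPolynomialIntegral.exists_centre_polynomial`). The reflection law says that
`θ ↦ P(γ(s) + r e^{iθ} n(s))` is even for all `s`.

*A conserved quantity.* Evenness makes `P` equal to a constant `c` on the parallel curve `γ + r n`.
On a suitable arc the polynomials vanishing on the parallel curve form a principal ideal `(f)` with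
`f` prime. Write `P - c = fᵐ g` with `f ∤ g` and expand `f = a₂ θ² + a₃ θ³ + ⋯` and
`g = p₀ + p₁ θ + ⋯` on the Larmor circle centred at `γ(s)`. Evenness gives
`m a₃ p₀ + a₂ p₁ = 0` where `a₂ ≠ 0`. The parallel curve and the Larmor circle are tangent at
`γ(s) + r n(s)`, with the velocities `-λ J n` for `λ = 1 - r κ` and `r J n`, so `a₃` and `p₁` are
combinations of `a₂`, `λ`, `p₀` and their derivatives in `s`, and the relation integrates to
`a₂³ᵐ λ²ᵐ p₀³ = const` (`IsTable.hasDerivAt_conserved`). The constant is not zero, because `f` is an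
irreducible equation of the curve and does not divide `g`.

*Finitely many `β`.* Let `A` be the ring of functions generated over `ℂ` by `γ, γ̄, n, n̄, κ` on an
arc so short that `A` is an integral domain (`IsTable.exists_isPrime_curveIdeal`). It does not depend on
`β`. The conserved quantity lies in `A` and is divisible by `λ = -r (κ - β)`, so each exceptional
`β` makes `κ - β` a unit of `A` (`IsPolynomialIntegral.isUnit_curvature_sub`). If `κ` is not constant it
is transcendental over `ℂ`, and by Chevalley's theorem it omits only finitely many values on
`Spec A` (`finite_setOf_isUnit_sub_algebraMap`). If `κ` is constant, `γ` is a circle and `Ω` is a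
disc (`IsTable.exists_eq_ball_of_curvature_eq`).
-/

noncomputable section

namespace MagneticBilliard

/-! ### Commutative algebra -/

/-- The closed point `X = b` of the affine line. -/
def affineLinePoint {k : Type*} [Field k] (b : k) : PrimeSpectrum (Polynomial k) :=
  ⟨Ideal.span {Polynomial.X - Polynomial.C b},
    (Ideal.span_singleton_prime (Polynomial.X_sub_C_ne_zero b)).2 (Polynomial.prime_X_sub_C b)⟩

/-- A constructible subset of the affine line contains all but finitely many closed points, or only
finitely many of them, according to whether it contains the generic point. -/
theorem finite_affineLinePoint_mem_ne_generic {k : Type*} [Field k]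
    {s : Set (PrimeSpectrum (Polynomial k))} (hs : IsConstructible s) :
    {b : k | ¬ (affineLinePoint b ∈ s ↔ (⊥ : PrimeSpectrum (Polynomial k)) ∈ s)}.Finite := by
  classical
  induction hs using IsConstructible.empty_union_induction with
  | open_retrocompact U hU _ =>
    obtain ⟨I, hI⟩ := (PrimeSpectrum.isClosed_iff_zeroLocus_ideal _).mp hU.isClosed_compl
    have hmem : ∀ x, x ∈ U ↔ ¬ (I ≤ x.asIdeal) := by
      intro x
      rw [← SetLike.coe_subset_coe, ← PrimeSpectrum.mem_zeroLocus, ← hI, mem_compl_iff, not_not]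
    by_cases hI0 : I = ⊥
    · refine Set.Finite.subset Set.finite_empty ?_
      intro b hb
      simp [hmem, hI0] at hb
    · obtain ⟨p, hp, hp0⟩ := Submodule.exists_mem_ne_zero_of_ne_bot hI0
      refine Set.Finite.subset (p.roots.toFinset.finite_toSet) ?_
      intro b hb
      have hbot : (⊥ : PrimeSpectrum (Polynomial k)) ∈ U := by
        rw [hmem]
        intro h
        exact hI0 (le_bot_iff.1 h)
      have hb' : I ≤ (affineLinePoint b).asIdeal := by
        by_contra h
        exact hb (iff_of_true ((hmem _).2 h) hbot)
      have := hb' hp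
      rw [affineLinePoint, Ideal.mem_span_singleton, Polynomial.dvd_iff_isRoot] at this
      simpa [hp0] using this
  | union s hs t ht ihs iht =>
    refine (ihs.union iht).subset ?_
    intro b hb
    simp only [mem_union, mem_ofPred_eq] at hb ⊢
    tauto
  | compl s hs ih =>
    refine ih.subset ?_
    intro b hb
    simp only [mem_compl_iff, mem_ofPred_eq] at hb ⊢
    tauto

/-- A transcendental function on an irreducible affine variety omits only finitely many values. -/
theorem finite_setOf_isUnit_sub_algebraMap {k A : Type*} [Field k] [CommRing A] [IsDomain A]
    [Algebra k A] [Algebra.FiniteType k A] (x : A) (hx : Transcendental k x) :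
    {b : k | IsUnit (x - algebraMap k A b)}.Finite := by
  set f : Polynomial k →+* A := (Polynomial.aeval x : Polynomial k →ₐ[k] A).toRingHom with hf
  have hfin : f.FinitePresentation := by
    apply RingHom.FinitePresentation.of_finiteType.1
    refine RingHom.FiniteType.of_comp_finiteType (f := algebraMap k (Polynomial k)) ?_
    have : f.comp (algebraMap k (Polynomial k)) = algebraMap k A := by
      ext b
      simp [hf]
    rw [this, RingHom.finiteType_algebraMap]
    infer_instance
  have hinj : Function.Injective f := transcendental_iff_injective.1 hx
  refine (finite_affineLinePoint_mem_ne_generic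
    (PrimeSpectrum.isConstructible_range_comap hfin)).subset ?_
  intro b hb hiff
  have hgen : (⊥ : PrimeSpectrum (Polynomial k)) ∈ range (PrimeSpectrum.comap f) := by
    refine ⟨⊥, ?_⟩
    ext1
    exact (RingHom.injective_iff_ker_eq_bot f).1 hinj
  obtain ⟨q, hq⟩ := hiff.2 hgen
  have hmem : (Polynomial.X - Polynomial.C b) ∈ (affineLinePoint b).asIdeal :=
    Ideal.mem_span_singleton_self _
  rw [← hq, PrimeSpectrum.comap_asIdeal, Ideal.mem_comap] at hmem
  have hfx : f (Polynomial.X - Polynomial.C b) = x - algebraMap k A b := by simp [hf]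
  rw [hfx] at hmem
  exact q.isPrime.ne_top (Ideal.eq_top_of_isUnit_mem _ hmem hb)

/-- A nonzero prime ideal of `K[X, Y]` that is not the ideal of a point is principal. -/
theorem exists_prime_eq_span_singleton {K : Type*} [Field K] [IsAlgClosed K]
    (I : Ideal (MvPolynomial (Fin 2) K)) [hI : I.IsPrime] (h0 : I ≠ ⊥)
    (hpt : ∀ x : Fin 2 → K, I ≠ MvPolynomial.vanishingIdeal K {x}) :
    ∃ f, Prime f ∧ I = Ideal.span {f} := by
  obtain ⟨f, hfI, hf⟩ := hI.exists_mem_prime_of_ne_bot h0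
  -- The ring has dimension two, and its maximal ideals are those of points, so `I` has height one.
  refine ⟨f, hf, Ideal.eq_span_singleton_of_height_eq_one ?_ hfI hf⟩
  have hdim : ringKrullDim (MvPolynomial (Fin 2) K) = 2 := by
    simp [MvPolynomial.ringKrullDim_of_isNoetherianRing]
  have : FiniteRingKrullDim (MvPolynomial (Fin 2) K) := by
    rw [finiteRingKrullDim_iff_ne_bot_and_top, hdim]
    exact ⟨by decide, by decide⟩
  have hle : (I.height : WithBot ℕ∞) ≤ 2 := hdim ▸ I.height_le_ringKrullDim_of_isPrime
  have hne2 : I.height ≠ 2 := by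
    intro h
    have : I.IsMaximal := by
      apply Ideal.isMaximal_of_height_eq_ringKrullDim
      rw [h, hdim]; rfl
    obtain ⟨x, hx⟩ := MvPolynomial.isMaximal_iff_eq_vanishingIdeal_singleton.1 this
    exact hpt x hx
  have hne0 : I.height ≠ 0 := by
    rw [Ne, Ideal.height_eq_zero_iff_eq_bot]; exact h0
  have hle' : I.height ≤ 2 := WithBot.coe_le_coe.1 hle
  generalize I.height = a at *
  lift a to ℕ using (ne_top_of_le_ne_top (by decide) hle')
  norm_cast at *
  omega

/-- A nonzero partial derivative has smaller degree, so it is not a multiple of the polynomial. -/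
theorem MvPolynomial.pderiv_eq_zero_of_dvd {K : Type*} [Field K] {σ : Type*}
    {f : MvPolynomial σ K} {i : σ} (h : f ∣ MvPolynomial.pderiv i f) :
    MvPolynomial.pderiv i f = 0 := by
  by_contra h0
  obtain ⟨g, hg⟩ := h
  have hf0 : f ≠ 0 := by rintro rfl; simp at h0
  have hg0 : g ≠ 0 := by rintro rfl; simp at hg; exact h0 hg
  have hdeg : (MvPolynomial.pderiv i f).totalDegree < f.totalDegree := by
    obtain ⟨m, hm, hmd⟩ := Finset.exists_mem_eq_sup (MvPolynomial.pderiv i f).support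
      (MvPolynomial.support_nonempty.2 h0) (fun s => s.sum fun _ e => e)
    rw [MvPolynomial.totalDegree, hmd]
    rw [MvPolynomial.mem_support_iff, MvPolynomial.coeff_pderiv] at hm
    have hm' : m + Finsupp.single i 1 ∈ f.support :=
      MvPolynomial.mem_support_iff.2 (left_ne_zero_of_mul hm)
    have := MvPolynomial.le_totalDegree hm'
    rw [Finsupp.sum_add_index' (by simp) (by simp)] at this
    simp at this
    omega
  rw [hg, MvPolynomial.totalDegree_mul_of_isDomain hf0 hg0] at hdeg
  omega

theorem MvPolynomial.eq_C_of_pderiv_eq_zero {K : Type*} [Field K] [CharZero K] {σ : Type*}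
    {f : MvPolynomial σ K} (h : ∀ i, MvPolynomial.pderiv i f = 0) :
    f = MvPolynomial.C (MvPolynomial.coeff 0 f) := by
  classical
  ext m
  rw [MvPolynomial.coeff_C]
  split_ifs with hm
  · rw [hm]
  · obtain ⟨i, hi⟩ : ∃ i, m i ≠ 0 := by
      by_contra! hcon
      exact hm (Finsupp.ext (by simpa using hcon)).symm
    have := MvPolynomial.coeff_pderiv (i := i) f (m - Finsupp.single i 1)
    rw [h i, tsub_add_cancel_of_le
      (Finsupp.single_le_iff.2 (Nat.one_le_iff_ne_zero.2 hi))] at this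
    rw [MvPolynomial.coeff_zero] at this
    rcases mul_eq_zero.1 this.symm with h1 | h1
    · exact h1
    · exact absurd h1 (Nat.cast_add_one_ne_zero _)

/-! ### The boundary curve and its tubular neighbourhood -/

/-- A preconnected set that meets `U` but not its frontier lies in `U`. -/
theorem subset_of_isPreconnected_of_disjoint_frontier {X : Type*} [TopologicalSpace X]
    {S U : Set X} (hS : IsPreconnected S) (hd : Disjoint S (frontier U))
    (hne : (S ∩ U).Nonempty) : S ⊆ U := by
  have h := hS.subset_left_of_subset_union (u := interior U) (v := (closure U)ᶜ) isOpen_interior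
    isClosed_closure.isOpen_compl
    (disjoint_compl_right.mono_left (interior_subset.trans subset_closure)) ?_ ?_
  · exact h.trans interior_subset
  · intro x hx
    by_cases hxc : x ∈ closure U
    · left
      by_contra hxi
      exact hd.le_bot ⟨hx, hxc, hxi⟩
    · exact Or.inr hxc
  · obtain ⟨x, hx, hxU⟩ := hne
    refine ⟨x, hx, ?_⟩
    by_contra hxi
    exact hd.le_bot ⟨hx, subset_closure hxU, hxi⟩

/-- The signed curvature of a curve parametrized by arc length. -/
def curvature (γ : ℝ → ℂ) (s : ℝ) : ℝ := (deriv (deriv γ) s * (starRingEnd ℂ) (deriv γ s)).im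

theorem mul_conj_eq_one {w : ℂ} (hw : ‖w‖ = 1) : w * (starRingEnd ℂ) w = 1 := by
  rw [Complex.mul_conj, Complex.normSq_eq_norm_sq, hw]; simp

theorem inner_eq_re (a b : ℂ) : inner ℝ a b = (b * (starRingEnd ℂ) a).re := by
  rw [Complex.inner, mul_comm]

section Curve

variable {Ω : Set ℂ} {γ : ℝ → ℂ} {L : ℝ}

theorem IsTable.contDiff_deriv (h : IsTable Ω γ L) : ContDiff ℝ ∞ (deriv γ) :=
  ((contDiff_infty_iff_deriv (f := γ)).1 h.smooth).2

theorem IsTable.hasDerivAt (h : IsTable Ω γ L) (s : ℝ) : HasDerivAt γ (deriv γ s) s :=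
  ((h.smooth.differentiable (by simp)) s).hasDerivAt

theorem IsTable.contDiff_normal (h : IsTable Ω γ L) : ContDiff ℝ ∞ (normal γ) :=
  contDiff_const.mul h.contDiff_deriv

theorem IsTable.contDiff_curvature (h : IsTable Ω γ L) : ContDiff ℝ ∞ (curvature γ) := by
  have h2 : ContDiff ℝ ∞ (deriv (deriv γ)) :=
    ((contDiff_infty_iff_deriv (f := deriv γ)).1 h.contDiff_deriv).2
  exact Complex.imCLM.contDiff.comp (h2.mul (Complex.conjCLE.contDiff.comp h.contDiff_deriv))

theorem IsTable.norm_normal (h : IsTable Ω γ L) (s : ℝ) : ‖normal γ s‖ = 1 := by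
  simp [normal, h.unit_speed s]

theorem normal_ne_zero (h : IsTable Ω γ L) (s : ℝ) : normal γ s ≠ 0 := by
  rw [← norm_ne_zero_iff, h.norm_normal]; exact one_ne_zero

theorem deriv_eq_neg_I_mul_normal (γ : ℝ → ℂ) (s : ℝ) :
    deriv γ s = -Complex.I * normal γ s := by
  rw [normal]; linear_combination deriv γ s * Complex.I_mul_I

/-- The Frenet equation. -/
theorem IsTable.hasDerivAt_deriv (h : IsTable Ω γ L) (s : ℝ) :
    HasDerivAt (deriv γ) (Complex.I * curvature γ s * deriv γ s) s := by
  have h1 : HasDerivAt (deriv γ) (deriv (deriv γ) s) s :=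
    ((h.contDiff_deriv.differentiable (by simp)) s).hasDerivAt
  have h2 : HasDerivAt (fun u => (starRingEnd ℂ) (deriv γ u))
      ((starRingEnd ℂ) (deriv (deriv γ) s)) s :=
    (Complex.conjCLE.hasFDerivAt.comp_hasDerivAt s h1)
  have h3 := h1.mul h2
  have h4 : (fun u => deriv γ u * (starRingEnd ℂ) (deriv γ u)) = fun _ => 1 := by
    funext u; exact mul_conj_eq_one (h.unit_speed u)
  have h5 := h3.unique (by
    have : (deriv γ * fun u => (starRingEnd ℂ) (deriv γ u)) = fun _ => 1 := h4
    rw [this]; exact hasDerivAt_const s (1 : ℂ))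
  convert h1 using 1
  have hre : (deriv (deriv γ) s * (starRingEnd ℂ) (deriv γ s)).re = 0 := by
    have := congrArg Complex.re h5
    simp at this ⊢
    linarith
  have key : deriv (deriv γ) s * (starRingEnd ℂ) (deriv γ s) = Complex.I * curvature γ s := by
    apply Complex.ext
    · rw [hre]; simp
    · simp [curvature]
  have h6 := mul_conj_eq_one (h.unit_speed s)
  rw [← key]
  linear_combination (deriv (deriv γ) s) * h6

theorem IsTable.hasDerivAt_normal (h : IsTable Ω γ L) (s : ℝ) :
    HasDerivAt (normal γ) (Complex.I * curvature γ s * normal γ s) s := by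
  have h1 := (h.hasDerivAt_deriv s).const_mul Complex.I
  have h2 : Complex.I * (Complex.I * curvature γ s * deriv γ s) =
      Complex.I * curvature γ s * normal γ s := by simp only [normal]; ring
  rw [h2] at h1
  exact h1

theorem IsTable.contDiff_normalMap (h : IsTable Ω γ L) : ContDiff ℝ ∞ (normalMap γ) := by
  unfold normalMap
  exact (h.smooth.comp contDiff_fst).add (contDiff_snd.smul (h.contDiff_normal.comp contDiff_fst))

theorem IsTable.exists_mem_Ico (h : IsTable Ω γ L) (s : ℝ) :
    ∃ u ∈ Ico 0 L, γ s = γ u ∧ normal γ s = normal γ u := by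
  have hper : Function.Periodic (fun s => (γ s, normal γ s)) L := by
    intro s
    have h1 : deriv γ (s + L) = deriv γ s := by
      have : (fun x => γ (x + L)) = γ := funext h.periodic
      conv_rhs => rw [← this]
      rw [deriv_comp_add_const]
    simp [normal, h.periodic s, h1]
  obtain ⟨u, hu, hus⟩ := hper.exists_mem_Ico₀ h.length_pos s
  exact ⟨u, hu, congrArg Prod.fst hus, congrArg Prod.snd hus⟩

/-- On a tubular neighbourhood the normal coordinates are determined by the point. -/
theorem IsTubularRadius.normalMap_injective (h : IsTable Ω γ L) {ρ : ℝ}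
    (hρ : IsTubularRadius γ L ρ) {s t s' t' : ℝ} (ht : t ∈ Ioo (-ρ) ρ) (ht' : t' ∈ Ioo (-ρ) ρ)
    (heq : normalMap γ (s, t) = normalMap γ (s', t')) : t = t' ∧ γ s = γ s' := by
  obtain ⟨u, hu, h1, h2⟩ := h.exists_mem_Ico s
  obtain ⟨u', hu', h1', h2'⟩ := h.exists_mem_Ico s'
  have heq' : normalMap γ (u, t) = normalMap γ (u', t') := by
    simpa [normalMap, h1, h2, h1', h2'] using heq
  have := hρ.2.1 (show (u, t) ∈ _ from ⟨hu, ht⟩) (show (u', t') ∈ _ from ⟨hu', ht'⟩) heq'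
  rw [Prod.mk.injEq] at this
  refine ⟨this.2, ?_⟩
  rw [h1, h1', this.1]

theorem IsTable.fderiv_normalMap (h : IsTable Ω γ L) (s t a b : ℝ) :
    fderiv ℝ (normalMap γ) (s, t) (a, b) =
      (a * (1 - t * curvature γ s)) • deriv γ s + b • normal γ s := by
  have h1 : HasFDerivAt (normalMap γ) (fderiv ℝ (normalMap γ) (s, t)) (s, t) :=
    ((h.contDiff_normalMap.differentiable (by simp)) (s, t)).hasFDerivAt
  have hline : HasDerivAt (fun τ : ℝ => (s + τ * a, t + τ * b)) (a, b) 0 := by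
    have e1 : HasDerivAt (fun τ : ℝ => s + τ * a) a 0 := by
      simpa using ((hasDerivAt_id (0 : ℝ)).mul_const a).const_add s
    have e2 : HasDerivAt (fun τ : ℝ => t + τ * b) b 0 := by
      simpa using ((hasDerivAt_id (0 : ℝ)).mul_const b).const_add t
    exact e1.prodMk e2
  have h2 : HasDerivAt (fun τ : ℝ => normalMap γ (s + τ * a, t + τ * b))
      (fderiv ℝ (normalMap γ) (s, t) (a, b)) 0 := by
    have := HasFDerivAt.comp_hasDerivAt (x := (0 : ℝ)) (f := fun τ : ℝ => (s + τ * a, t + τ * b))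
      (l := normalMap γ) (l' := fderiv ℝ (normalMap γ) (s, t)) (by simpa using h1) hline
    exact this
  have e1 : HasDerivAt (fun τ : ℝ => s + τ * a) a 0 := by
    simpa using ((hasDerivAt_id (0 : ℝ)).mul_const a).const_add s
  have e2 : HasDerivAt (fun τ : ℝ => t + τ * b) b 0 := by
    simpa using ((hasDerivAt_id (0 : ℝ)).mul_const b).const_add t
  have g1 : HasDerivAt (fun τ : ℝ => γ (s + τ * a)) (a • deriv γ s) 0 :=
    HasDerivAt.scomp (x := (0 : ℝ)) (h := fun τ : ℝ => s + τ * a) (by simpa using h.hasDerivAt s) e1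
  have g2 : HasDerivAt (fun τ : ℝ => normal γ (s + τ * a))
      (a • (Complex.I * curvature γ s * normal γ s)) 0 :=
    HasDerivAt.scomp (x := (0 : ℝ)) (g₁ := normal γ) (h := fun τ : ℝ => s + τ * a)
      (by simpa using h.hasDerivAt_normal s) e1
  have h3 : HasDerivAt (fun τ : ℝ => normalMap γ (s + τ * a, t + τ * b)) _ 0 :=
    g1.add (e2.smul g2)
  rw [h2.unique h3, deriv_eq_neg_I_mul_normal]
  simp only [Complex.real_smul]
  push_cast
  simp
  ring

/-- The Jacobian of the normal map does not vanish on the tubular neighbourhood. -/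
theorem IsTubularRadius.one_sub_mul_curvature_ne_zero (h : IsTable Ω γ L) {ρ : ℝ}
    (hρ : IsTubularRadius γ L ρ) (s : ℝ) {t : ℝ} (ht : t ∈ Ioo (-ρ) ρ) :
    1 - t * curvature γ s ≠ 0 := by
  intro h0
  have h1 := h.fderiv_normalMap s t 1 0
  rw [h0] at h1
  have h2 : fderiv ℝ (normalMap γ) (s, t) (1, 0) = fderiv ℝ (normalMap γ) (s, t) 0 := by
    rw [h1]; simp
  have := (hρ.2.2 s t ht).1 h2
  simp at this

theorem exists_isTubularRadius_gt {R : ℝ} (hR : 0 < R) (h : R < tubularRadius γ L) :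
    ∃ ρ, R < ρ ∧ IsTubularRadius γ L ρ := by
  have hne : {ρ : ℝ | IsTubularRadius γ L ρ}.Nonempty := by
    by_contra hempty
    rw [Set.not_nonempty_iff_eq_empty] at hempty
    rw [tubularRadius, hempty, Real.sSup_empty] at h
    linarith
  obtain ⟨ρ, hρ, hlt⟩ := exists_lt_of_lt_csSup hne h
  exact ⟨ρ, hlt, hρ⟩

theorem IsTable.isCompact_range (h : IsTable Ω γ L) : IsCompact (range γ) := by
  rw [← h.frontier_eq]
  exact Metric.isCompact_of_isClosed_isBounded isClosed_frontier
    (h.isBounded.closure.subset frontier_subset_closure)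

/-- A point is reached from its nearest boundary point along the normal. -/
theorem IsTable.exists_normalMap_eq (h : IsTable Ω γ L) (x : ℂ) :
    ∃ s t : ℝ, normalMap γ (s, t) = x ∧ ∀ u, |t| ≤ ‖x - γ u‖ := by
  obtain ⟨_, ⟨s, rfl⟩, hs⟩ := h.isCompact_range.exists_isMinOn (range_nonempty γ)
    (f := fun y => ‖x - y‖) (by fun_prop)
  have hmin : ∀ u, ‖x - γ s‖ ≤ ‖x - γ u‖ := fun u => hs (mem_range_self u)
  have hd : HasDerivAt (fun u => ‖x - γ u‖ ^ 2) (2 * inner ℝ (x - γ s) (-deriv γ s)) s :=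
    ((h.hasDerivAt s).const_sub x).norm_sq
  have hloc : IsLocalMin (fun u => ‖x - γ u‖ ^ 2) s :=
    Eventually.of_forall fun u => pow_le_pow_left₀ (norm_nonneg _) (hmin u) 2
  have h0 := hloc.hasDerivAt_eq_zero hd
  set w := x - γ s with hw
  have hre : (w * (starRingEnd ℂ) (deriv γ s)).re = 0 := by
    rw [inner_neg_right, inner_eq_re] at h0
    simp at h0 ⊢
    linarith
  set t := (w * (starRingEnd ℂ) (deriv γ s)).im with ht
  have hwt : w = t • normal γ s := by
    have h1 : w * (starRingEnd ℂ) (deriv γ s) = Complex.I * t := by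
      apply Complex.ext
      · rw [hre]; simp
      · simp [ht]
    have h6 := mul_conj_eq_one (h.unit_speed s)
    rw [normal, Complex.real_smul]
    linear_combination deriv γ s * h1 - w * h6
  refine ⟨s, t, ?_, ?_⟩
  · simp only [normalMap]
    rw [← hwt, hw]; ring
  · intro u
    have : ‖w‖ = |t| := by rw [hwt, norm_smul, h.norm_normal]; simp
    rw [← this]
    exact hmin u

/-- The discs of radius less than that of a tubular neighbourhood that touch the boundary from the
inside lie in the domain. -/
theorem IsTubularRadius.ball_subset (h : IsTable Ω γ L) {ρ R : ℝ} (hρ : IsTubularRadius γ L ρ)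
    (hR : 0 < R) (hRρ : R < ρ) (s : ℝ) : Metric.ball (normalMap γ (s, R)) R ⊆ Ω := by
  refine subset_of_isPreconnected_of_disjoint_frontier (convex_ball _ _).isPreconnected ?_ ?_
  · rw [h.frontier_eq, Set.disjoint_right]
    rintro _ ⟨u, rfl⟩ hu
    obtain ⟨s', t, ht, hmin⟩ := h.exists_normalMap_eq (normalMap γ (s, R))
    have h1 : |t| < R := by
      rw [Metric.mem_ball, dist_comm, dist_eq_norm] at hu
      exact (hmin u).trans_lt hu
    have h2 := abs_lt.1 h1
    have := (hρ.normalMap_injective h ⟨by linarith, by linarith⟩ ⟨by linarith, hRρ⟩ ht).1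
    linarith
  · have h1 : ∀ᶠ t : ℝ in 𝓝[>] 0, t < R := by
      filter_upwards [Ioo_mem_nhdsGT hR] with t ht using ht.2
    obtain ⟨t, ⟨htΩ, htR⟩, ht0⟩ := ((h.inward s).and h1 |>.and self_mem_nhdsWithin).exists
    refine ⟨_, ?_, htΩ⟩
    rw [Metric.mem_ball, dist_eq_norm]
    have : γ s + t • (Complex.I * deriv γ s) - normalMap γ (s, R) = (t - R) • normal γ s := by
      simp only [normalMap, normal, sub_smul]; ring
    rw [this, norm_smul, h.norm_normal, mul_one, Real.norm_eq_abs, abs_lt]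
    have : 0 < t := ht0
    constructor <;> linarith

/-- The open annulus between `γ` and the parallel curve `γ_{2r}`. -/
def openAnnulus (γ : ℝ → ℂ) (β : ℝ) : Set ℂ :=
  normalMap γ '' (univ ×ˢ Ioo 0 (2 * larmorRadius β))

theorem openAnnulus_subset_closedAnnulus (γ : ℝ → ℂ) (β : ℝ) :
    openAnnulus γ β ⊆ closedAnnulus γ β :=
  image_mono (prod_mono_right Ioo_subset_Icc_self)

theorem IsTable.isPreconnected_openAnnulus (h : IsTable Ω γ L) (β : ℝ) :
    IsPreconnected (openAnnulus γ β) :=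
  (isPreconnected_univ.prod isPreconnected_Ioo).image _ h.contDiff_normalMap.continuous.continuousOn

theorem IsTubularRadius.isOpen_openAnnulus (h : IsTable Ω γ L) {ρ β : ℝ}
    (hρ : IsTubularRadius γ L ρ) (hβ : 2 * larmorRadius β < ρ) : IsOpen (openAnnulus γ β) := by
  rw [isOpen_iff_mem_nhds]
  rintro _ ⟨⟨s, t⟩, ⟨-, ht⟩, rfl⟩
  have hbij := hρ.2.2 s t ⟨by linarith [ht.1, ht.2], by linarith [ht.2]⟩
  have hstrict : HasStrictFDerivAt (normalMap γ) (fderiv ℝ (normalMap γ) (s, t)) (s, t) :=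
    h.contDiff_normalMap.contDiffAt.hasStrictFDerivAt (by simp)
  rw [← hstrict.map_nhds_eq_of_surj (LinearMap.range_eq_top.2 hbij.2)]
  exact image_mem_map ((isOpen_univ.prod isOpen_Ioo).mem_nhds ⟨mem_univ s, ht⟩)

end Curve

/-! ### Larmor arcs through the annulus -/

theorem larmorRadius_pos {β : ℝ} (hβ : 0 < β) : 0 < larmorRadius β := one_div_pos.2 hβ

theorem velocity_zero (β : ℝ) (v : ℂ) : velocity β v 0 = v := by simp [velocity]

theorem position_zero (β : ℝ) (x v : ℂ) : position β x v 0 = x := by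
  simp [position, velocity_zero]

theorem norm_velocity (β : ℝ) (v : ℂ) (t : ℝ) : ‖velocity β v t‖ = ‖v‖ := by
  rw [velocity, norm_mul, Complex.norm_exp_ofReal_mul_I, one_mul]

theorem velocity_add (β : ℝ) (v : ℂ) (t u : ℝ) :
    velocity β v (t + u) = velocity β (velocity β v t) u := by
  simp only [velocity]
  rw [← mul_assoc, ← Complex.exp_add]
  congr 2
  push_cast
  ring

theorem position_add (β : ℝ) (x v : ℂ) (t u : ℝ) :
    position β x v (t + u) = position β (position β x v t) (velocity β v t) u := by
  simp only [position, velocity_add]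
  ring

/-- The chord of a Larmor arc makes half of the turning angle with the initial velocity. -/
theorem position_eq_add_chord {β : ℝ} (hβ : β ≠ 0) (x v : ℂ) (u : ℝ) :
    position β x v (2 * larmorRadius β * u) =
      x + (2 * larmorRadius β * Real.sin u : ℝ) * (v * Complex.exp (u * Complex.I)) := by
  have h1 : β * (2 * larmorRadius β * u) = u + u := by
    rw [larmorRadius]; field_simp; ring
  rw [position, velocity, h1]
  simp only [Complex.real_smul]
  push_cast
  have h2 : Complex.exp (u * Complex.I) * Complex.exp (-(u * Complex.I)) = 1 := by
    rw [← Complex.exp_add]; simp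
  have h3 : Complex.exp (((u : ℂ) + u) * Complex.I) =
      Complex.exp (u * Complex.I) * Complex.exp (u * Complex.I) := by
    rw [← Complex.exp_add]; ring_nf
  rw [h3, Complex.sin, neg_mul]
  linear_combination -(larmorRadius β : ℂ) * Complex.I * v * h2

/-- A chord that is short compared to its inclination stays in the disc of radius `R` touching
the boundary at its initial point. -/
theorem mem_ball_of_chord {q n e : ℂ} {R a : ℝ} (hn : ‖n‖ = 1) (he : ‖e‖ = 1) (hR : 0 < R)
    (ha : 0 < a) (h : a < 2 * R * (e * (starRingEnd ℂ) n).re) :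
    q + (a : ℂ) * e ∈ Metric.ball (q + R • n) R := by
  rw [Metric.mem_ball, dist_eq_norm]
  refine lt_of_pow_lt_pow_left₀ 2 hR.le ?_
  have h1 : (q + (a : ℂ) * e - (q + R • n)) = (a : ℂ) * e - (R : ℂ) * n := by
    rw [Complex.real_smul]; ring
  rw [h1, Complex.sq_norm, Complex.normSq_sub, ← Complex.sq_norm, ← Complex.sq_norm, norm_mul,
    norm_mul, he, hn]
  simp only [Complex.norm_real, Real.norm_eq_abs, mul_one, sq_abs, map_mul, Complex.conj_ofReal]
  have h2 : ((a : ℂ) * e * ((R : ℂ) * (starRingEnd ℂ) n)).re =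
      a * R * (e * (starRingEnd ℂ) n).re := by
    rw [show (a : ℂ) * e * ((R : ℂ) * (starRingEnd ℂ) n) =
      ((a * R : ℝ) : ℂ) * (e * (starRingEnd ℂ) n) by push_cast; ring, Complex.re_ofReal_mul]
  rw [h2]
  nlinarith

section

variable {Ω : Set ℂ} {γ : ℝ → ℂ} {L : ℝ}

/-- The velocities `w` with which the point `x` is reached along a Larmor arc in `Ω` that starts
at the boundary. -/
def arrivalVelocities (Ω : Set ℂ) (γ : ℝ → ℂ) (β : ℝ) (x : ℂ) : Set ℂ :=
  {w | ∃ (s : ℝ) (v : ℂ) (τ : ℝ), ‖v‖ = 1 ∧ 0 < inner ℝ (normal γ s) v ∧ 0 < τ ∧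
    position β (γ s) v τ = x ∧ velocity β v τ = w ∧ ∀ σ ∈ Ioc 0 τ, position β (γ s) v σ ∈ Ω}

/-- The arc of angle less than `π` from `γ(s')` to `x` lies in `Ω` if `s'` is close to the foot
`s` of the normal through `x`. -/
theorem IsTubularRadius.eventually_exists_arc (h : IsTable Ω γ L) {ρ β : ℝ} (hβ : 0 < β)
    (hρ : IsTubularRadius γ L ρ) (hβρ : 2 * larmorRadius β < ρ) (s : ℝ) {t : ℝ}
    (ht : t ∈ Ioo 0 (2 * larmorRadius β)) :
    ∀ᶠ s' in 𝓝 s, ∃ (v : ℂ) (τ : ℝ), ‖v‖ = 1 ∧ 0 < inner ℝ (normal γ s') v ∧ 0 < τ ∧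
      position β (γ s') v τ = normalMap γ (s, t) ∧
      ∀ σ ∈ Ioc 0 τ, position β (γ s') v σ ∈ Ω := by
  set r := larmorRadius β with hr
  have hrpos : 0 < r := larmorRadius_pos hβ
  set R := 2 * r with hR
  set x := normalMap γ (s, t) with hx
  set ℓ : ℝ → ℝ := fun s' => ‖x - γ s'‖ with hℓ
  set U : ℝ → ℝ := fun s' => Real.arcsin (ℓ s' / (2 * r)) with hU
  set e : ℝ → ℂ := fun s' => (x - γ s') / (ℓ s' : ℂ) with he
  have hγc : Continuous γ := h.smooth.continuous
  have hnc : Continuous (normal γ) := h.contDiff_normal.continuous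
  have hxs : x - γ s = t • normal γ s := by simp [hx, normalMap]
  have hℓs : ℓ s = t := by
    simp only [hℓ]
    rw [hxs, norm_smul, h.norm_normal, mul_one, Real.norm_eq_abs, abs_of_pos ht.1]
  have hes : e s = normal γ s := by
    simp only [he]
    rw [hℓs, hxs, Complex.real_smul]
    field_simp [ht.1.ne']
  have hℓc : Continuous ℓ := by fun_prop
  have hUc : Continuous U := Real.continuous_arcsin.comp (hℓc.div_const _)
  have hec : ContinuousAt e s := by
    refine ContinuousAt.div (by fun_prop) (by fun_prop) ?_
    rw [hℓs]; exact_mod_cast ht.1.ne'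
  have hbound : ∀ᶠ s' in 𝓝 s, 0 < ℓ s' ∧ ℓ s' < 2 * r :=
    (hℓc.continuousAt.eventually_const_lt (by rw [hℓs]; exact ht.1)).and
      (hℓc.continuousAt.eventually_lt_const (by rw [hℓs]; exact ht.2))
  -- The arc stays in the disc as long as this function of the remaining half-angle is positive.
  set g : ℝ → ℝ → ℝ := fun s' w =>
    R * (e s' * Complex.exp (-(w * Complex.I)) * (starRingEnd ℂ) (normal γ s')).re
      - r * Real.sin (U s' - w) with hg
  have hcompact : ∀ᶠ s' in 𝓝 s, ∀ w ∈ Icc 0 (Real.pi / 2), 0 < g s' w := by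
    refine (isCompact_Icc).eventually_forall_of_forall_eventually ?_
    intro w hw
    have hgc : ContinuousAt (fun z : ℝ × ℝ => g z.1 z.2) (s, w) := by
      simp only [hg]
      have h1 : ContinuousAt (fun z : ℝ × ℝ => e z.1) (s, w) :=
        ContinuousAt.comp (f := Prod.fst) (x := (s, w)) hec continuousAt_fst
      have h2 : Continuous (fun z : ℝ × ℝ => Complex.exp (-(z.2 * Complex.I))) := by fun_prop
      have h3 : Continuous (fun z : ℝ × ℝ => (starRingEnd ℂ) (normal γ z.1)) :=
        Complex.continuous_conj.comp (hnc.comp continuous_fst)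
      have h4 : Continuous (fun z : ℝ × ℝ => r * Real.sin (U z.1 - z.2)) := by fun_prop
      exact ((Complex.continuous_re.continuousAt.comp
        ((h1.mul h2.continuousAt).mul h3.continuousAt)).const_mul _ |>.sub h4.continuousAt)
    refine hgc.eventually_const_lt ?_
    have hsinU : Real.sin (U s) = t / (2 * r) := by
      simp only [hU]
      rw [hℓs, Real.sin_arcsin]
      · have := div_pos ht.1 (by positivity : 0 < 2 * r); linarith
      · rw [div_le_one (by positivity)]; exact ht.2.le
    have hcosU : 0 < Real.cos (U s) := by
      simp only [hU]
      rw [hℓs, Real.cos_arcsin]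
      apply Real.sqrt_pos.2
      have h1 : t / (2 * r) < 1 := by rw [div_lt_one (by positivity)]; exact ht.2
      have h0 : 0 < t / (2 * r) := div_pos ht.1 (by positivity)
      nlinarith
    have hre : (e s * Complex.exp (-(w * Complex.I)) * (starRingEnd ℂ) (normal γ s)).re
        = Real.cos w := by
      rw [hes, mul_right_comm, mul_conj_eq_one (h.norm_normal s), one_mul, ← neg_mul,
        ← Complex.ofReal_neg, Complex.exp_ofReal_mul_I_re, Real.cos_neg]
    simp only [hg]
    rw [hre, Real.sin_sub, hR]
    have hcw : 0 ≤ Real.cos w :=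
      Real.cos_nonneg_of_mem_Icc ⟨by linarith [hw.1, Real.pi_pos], hw.2⟩
    have hsw : 0 ≤ Real.sin w := Real.sin_nonneg_of_mem_Icc ⟨hw.1, by linarith [hw.2, Real.pi_pos]⟩
    have hsq := Real.sin_sq_add_cos_sq w
    have hs1 : Real.sin (U s) ≤ 1 := Real.sin_le_one _
    have key : 0 < (2 - Real.sin (U s)) * Real.cos w + Real.cos (U s) * Real.sin w := by
      rcases hcw.eq_or_lt with h0 | h0
      · have : 0 < Real.sin w := by
          rcases hsw.eq_or_lt with h1 | h1
          · rw [← h0, ← h1] at hsq; norm_num at hsq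
          · exact h1
        rw [← h0]
        simpa using mul_pos hcosU this
      · have h1 := mul_pos (by linarith : 0 < 2 - Real.sin (U s)) h0
        have h2 := mul_nonneg hcosU.le hsw
        linarith
    nlinarith [mul_pos hrpos key]
  filter_upwards [hbound, hcompact] with s' hb hc
  have hq : ℓ s' / (2 * r) ∈ Ioo (0 : ℝ) 1 :=
    ⟨div_pos hb.1 (by positivity), by rw [div_lt_one (by positivity)]; exact hb.2⟩
  have hUpos : 0 < U s' := Real.arcsin_pos.2 hq.1
  have hUlt : U s' < Real.pi / 2 := Real.arcsin_lt_pi_div_two.2 hq.2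
  have hsinU : 2 * r * Real.sin (U s') = ℓ s' := by
    simp only [hU]
    rw [Real.sin_arcsin (by linarith [hq.1]) hq.2.le]
    field_simp
  have he1 : ‖e s'‖ = 1 := by
    simp only [he]
    rw [norm_div, Complex.norm_real, Real.norm_eq_abs, abs_of_pos hb.1]
    exact div_self hb.1.ne'
  have hee : (ℓ s' : ℂ) * e s' = x - γ s' := by
    simp only [he]
    have : (ℓ s' : ℂ) ≠ 0 := by exact_mod_cast hb.1.ne'
    field_simp
  have hexp : ∀ w : ℝ, ‖Complex.exp (-(w * Complex.I))‖ = 1 := by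
    intro w
    rw [← neg_mul, ← Complex.ofReal_neg, Complex.norm_exp_ofReal_mul_I]
  refine ⟨e s' * Complex.exp (-(U s' * Complex.I)), 2 * r * U s', ?_, ?_, by positivity, ?_, ?_⟩
  · rw [norm_mul, he1, hexp, one_mul]
  · have := hc (U s') ⟨hUpos.le, hUlt.le⟩
    simp only [hg, sub_self, Real.sin_zero, mul_zero, sub_zero] at this
    rw [inner_eq_re]
    exact pos_of_mul_pos_right this (by positivity)
  · rw [position_eq_add_chord hβ.ne', ← hr, hsinU, mul_assoc, ← Complex.exp_add,
      neg_add_cancel, Complex.exp_zero, mul_one, hee]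
    ring
  · intro σ hσ
    obtain ⟨u, rfl⟩ : ∃ u, σ = 2 * r * u := ⟨σ / (2 * r), by field_simp⟩
    have hu0 : 0 < u := pos_of_mul_pos_right hσ.1 (by positivity)
    have huU : u ≤ U s' := le_of_mul_le_mul_left hσ.2 (by positivity)
    apply hρ.ball_subset h (by positivity : 0 < R) hβρ s'
    rw [position_eq_add_chord hβ.ne', ← hr]
    have hexp2 : Complex.exp (-(U s' * Complex.I)) * Complex.exp (u * Complex.I) =
        Complex.exp (-((U s' - u : ℝ) * Complex.I)) := by
      rw [← Complex.exp_add]; push_cast; ring_nf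
    rw [mul_assoc (e s'), hexp2]
    have hsu : 0 < Real.sin u := Real.sin_pos_of_pos_of_lt_pi hu0 (by linarith [Real.pi_pos])
    refine mem_ball_of_chord (h.norm_normal s') (by rw [norm_mul, he1, hexp, one_mul])
      (by positivity) (by positivity) ?_
    have := hc (U s' - u) ⟨by linarith, by linarith⟩
    simp only [hg, sub_sub_cancel] at this
    linarith

/-- Arcs from different boundary points to `x` arrive with different velocities: tracing the arc
back from `x`, the first boundary point met is its start. -/
theorem IsTubularRadius.infinite_arrivalVelocities (h : IsTable Ω γ L) {ρ β : ℝ} (hβ : 0 < β)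
    (hρ : IsTubularRadius γ L ρ) (hβρ : 2 * larmorRadius β < ρ) {x : ℂ}
    (hx : x ∈ openAnnulus γ β) : (arrivalVelocities Ω γ β x).Infinite := by
  obtain ⟨⟨s₀, t⟩, ⟨-, ht⟩, rfl⟩ := hx
  obtain ⟨s, hs, h1, h2⟩ := h.exists_mem_Ico s₀
  have hs₀ : normalMap γ (s₀, t) = normalMap γ (s, t) := by simp [normalMap, h1, h2]
  rw [hs₀]
  set x := normalMap γ (s, t)
  have hev := hρ.eventually_exists_arc h hβ hβρ s ht
  set A := {s' | ∃ (v : ℂ) (τ : ℝ), ‖v‖ = 1 ∧ 0 < inner ℝ (normal γ s') v ∧ 0 < τ ∧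
      position β (γ s') v τ = x ∧ ∀ σ ∈ Ioc 0 τ, position β (γ s') v σ ∈ Ω} with hA
  have hinf : (A ∩ Ioo s L).Infinite := by
    have hmem : A ∩ Ioo s L ∈ 𝓝[>] s :=
      inter_mem (mem_nhdsWithin_of_mem_nhds hev) (Ioo_mem_nhdsGT hs.2)
    obtain ⟨b, hb, hsub⟩ := (mem_nhdsGT_iff_exists_Ioo_subset' hs.2).1 hmem
    exact (Ioo_infinite hb).mono hsub
  choose! v τ hv hin hτ hpos hΩ using fun s' (hs' : s' ∈ A) => hs'
  have hinj : InjOn (fun s' => velocity β (v s') (τ s')) (A ∩ Ioo s L) := by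
    have key : ∀ a ∈ A, ∀ b ∈ A, velocity β (v a) (τ a) = velocity β (v b) (τ b) →
        τ a < τ b → False := by
      intro a ha b hb hvel hlt
      have hback : ∀ c ∈ A, position β x (velocity β (v c) (τ c)) (-τ c) = γ c := by
        intro c hc
        rw [← hpos c hc, ← position_add, add_neg_cancel, position_zero]
      have h1 : position β (γ b) (v b) (τ b - τ a) = γ a := by
        rw [← hback a ha, ← hpos b hb, hvel, ← position_add, sub_eq_add_neg]
      have h2 := hΩ b hb (τ b - τ a) ⟨by linarith, by linarith [hτ a ha]⟩
      rw [h1] at h2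
      have h3 : γ a ∈ frontier Ω := by rw [h.frontier_eq]; exact mem_range_self a
      exact (h.isOpen.inter_frontier_eq ▸ ⟨h2, h3⟩ : γ a ∈ (∅ : Set ℂ))
    intro a ha b hb hvel
    simp only at hvel
    rcases lt_trichotomy (τ a) (τ b) with hlt | heq | hlt
    · exact (key a ha.1 b hb.1 hvel hlt).elim
    · have h3 : γ a = γ b := by
        have e1 : position β x (velocity β (v a) (τ a)) (-τ a) = γ a := by
          rw [← hpos a ha.1, ← position_add, add_neg_cancel, position_zero]
        have e2 : position β x (velocity β (v b) (τ b)) (-τ b) = γ b := by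
          rw [← hpos b hb.1, ← position_add, add_neg_cancel, position_zero]
        rw [← e1, ← e2, hvel, heq]
      exact h.simple ⟨hs.1.trans ha.2.1.le, ha.2.2⟩ ⟨hs.1.trans hb.2.1.le, hb.2.2⟩ h3
    · exact (key b hb.1 a ha.1 hvel.symm hlt).elim
  refine (hinf.image hinj).mono ?_
  rintro _ ⟨a, ha, rfl⟩
  exact ⟨a, v a, τ a, hv a ha.1, hin a ha.1, hτ a ha.1, hpos a ha.1, rfl, hΩ a ha.1⟩

end

/-! ### Wirtinger derivatives and polynomials in `z` and `z̄` -/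

/-- The value of a polynomial in two variables at `(z, z̄)`. -/
def evalConj (p : MvPolynomial (Fin 2) ℂ) (z : ℂ) : ℂ :=
  MvPolynomial.eval ![z, (starRingEnd ℂ) z] p

/-- Chain rule for polynomials along a curve in `ℂ²`. -/
theorem hasDerivAt_eval_pair {f g : ℝ → ℂ} {f' g' : ℂ} {t : ℝ} (hf : HasDerivAt f f' t)
    (hg : HasDerivAt g g' t) (p : MvPolynomial (Fin 2) ℂ) :
    HasDerivAt (fun t => MvPolynomial.eval ![f t, g t] p)
      (MvPolynomial.eval ![f t, g t] (MvPolynomial.pderiv 0 p) * f' +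
        MvPolynomial.eval ![f t, g t] (MvPolynomial.pderiv 1 p) * g') t := by
  induction p using MvPolynomial.induction_on with
  | C a => simpa using hasDerivAt_const t a
  | add p q hp hq =>
    simp only [map_add]
    exact (hp.add hq).congr_deriv (by ring)
  | mul_X p i hp =>
    fin_cases i
    · simp only [MvPolynomial.pderiv_mul, map_mul, map_add, MvPolynomial.pderiv_X,
        MvPolynomial.eval_X]
      exact (hp.mul hf).congr_deriv (by simp; ring)
    · simp only [MvPolynomial.pderiv_mul, map_mul, map_add, MvPolynomial.pderiv_X,
        MvPolynomial.eval_X]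
      exact (hp.mul hg).congr_deriv (by simp; ring)

theorem contDiff_evalConj (p : MvPolynomial (Fin 2) ℂ) : ContDiff ℝ ∞ (evalConj p) := by
  unfold evalConj
  induction p using MvPolynomial.induction_on with
  | C a => simpa using contDiff_const
  | add p q hp hq => simpa using hp.add hq
  | mul_X p i hp =>
    simp only [map_mul, MvPolynomial.eval_X]
    refine hp.mul ?_
    fin_cases i
    · exact contDiff_id
    · exact Complex.conjCLE.contDiff

theorem fderiv_evalConj (p : MvPolynomial (Fin 2) ℂ) (z v : ℂ) :
    fderiv ℝ (evalConj p) z v = evalConj (MvPolynomial.pderiv 0 p) z * v +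
      evalConj (MvPolynomial.pderiv 1 p) z * (starRingEnd ℂ) v := by
  have h1 : HasFDerivAt (evalConj p) (fderiv ℝ (evalConj p) z) z :=
    ((contDiff_evalConj p).differentiable (by simp) z).hasFDerivAt
  have hline : HasDerivAt (fun τ : ℝ => z + τ * v) v 0 := by
    simpa using ((hasDerivAt_id (0 : ℝ)).ofReal_comp.mul_const v).const_add z
  have hconj : HasDerivAt (fun τ : ℝ => (starRingEnd ℂ) (z + τ * v)) ((starRingEnd ℂ) v) 0 :=
    Complex.conjCLE.hasFDerivAt.comp_hasDerivAt (0 : ℝ) hline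
  have h2 : HasDerivAt (fun τ : ℝ => evalConj p (z + τ * v)) (fderiv ℝ (evalConj p) z v) 0 :=
    HasFDerivAt.comp_hasDerivAt (x := (0 : ℝ)) (f := fun τ : ℝ => z + τ * v)
      (l := evalConj p) (by simpa using h1) hline
  have h3 := hasDerivAt_eval_pair hline hconj p
  have := h2.unique h3
  simpa [evalConj] using this

/-- A polynomial in `z` and `z̄` that vanishes on a nonempty open set is zero. -/
theorem eq_zero_of_evalConj_eq_zero {X : Set ℂ} (hX : IsOpen X) (hne : X.Nonempty)
    {p : MvPolynomial (Fin 2) ℂ} (hp : ∀ z ∈ X, evalConj p z = 0) : p = 0 := by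
  obtain ⟨z₀, hz₀⟩ := hne
  -- Change of coordinates from `z, z̄` to real and imaginary part, and its inverse.
  set toReal : MvPolynomial (Fin 2) ℂ →ₐ[ℂ] MvPolynomial (Fin 2) ℂ :=
    MvPolynomial.bind₁ ![MvPolynomial.X 0 + MvPolynomial.C Complex.I * MvPolynomial.X 1,
      MvPolynomial.X 0 - MvPolynomial.C Complex.I * MvPolynomial.X 1] with htoReal
  set ofReal : MvPolynomial (Fin 2) ℂ →ₐ[ℂ] MvPolynomial (Fin 2) ℂ :=
    MvPolynomial.bind₁ ![MvPolynomial.C (1 / 2) * (MvPolynomial.X 0 + MvPolynomial.X 1),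
      MvPolynomial.C (1 / (2 * Complex.I)) * (MvPolynomial.X 0 - MvPolynomial.X 1)] with hofReal
  have hinv : ∀ q, ofReal (toReal q) = q := by
    intro q
    have : ofReal.comp toReal = AlgHom.id ℂ _ := by
      ext i
      fin_cases i
      · simp only [htoReal, hofReal, AlgHom.comp_apply, MvPolynomial.bind₁_X_right, Fin.zero_eta,
          Matrix.cons_val_zero, map_add, map_mul, MvPolynomial.bind₁_C_right, Matrix.cons_val_one,
          AlgHom.id_apply, Matrix.cons_val_fin_one]
        rw [← mul_assoc, ← MvPolynomial.C_mul]
        have : Complex.I * (1 / (2 * Complex.I)) = 1 / 2 := by field_simp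
        rw [this]
        have h2 : (MvPolynomial.C (1 / 2 : ℂ) : MvPolynomial (Fin 2) ℂ) * 2 = 1 := by
          rw [← MvPolynomial.C_1, ← map_ofNat MvPolynomial.C 2, ← MvPolynomial.C_mul]; norm_num
        congr 1
        linear_combination MvPolynomial.X 0 * h2
      · simp only [htoReal, hofReal, AlgHom.comp_apply, MvPolynomial.bind₁_X_right, Fin.mk_one,
          Matrix.cons_val_zero, map_sub, map_mul, MvPolynomial.bind₁_C_right, Matrix.cons_val_one,
          AlgHom.id_apply, Matrix.cons_val_fin_one]
        rw [← mul_assoc, ← MvPolynomial.C_mul]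
        have : Complex.I * (1 / (2 * Complex.I)) = 1 / 2 := by field_simp
        rw [this]
        have h2 : (MvPolynomial.C (1 / 2 : ℂ) : MvPolynomial (Fin 2) ℂ) * 2 = 1 := by
          rw [← MvPolynomial.C_1, ← map_ofNat MvPolynomial.C 2, ← MvPolynomial.C_mul]; norm_num
        congr 1
        linear_combination MvPolynomial.X 1 * h2
    exact DFunLike.congr_fun this q
  suffices h : toReal p = 0 by rw [← hinv p, h, map_zero]
  have hcont : Continuous (fun q : ℝ × ℝ => (q.1 : ℂ) + Complex.I * q.2) := by fun_prop
  have hnhds : (fun q : ℝ × ℝ => (q.1 : ℂ) + Complex.I * q.2) ⁻¹' X ∈ 𝓝 (z₀.re, z₀.im) := by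
    refine hcont.continuousAt.preimage_mem_nhds (hX.mem_nhds ?_)
    simp only
    rwa [mul_comm, Complex.re_add_im]
  rw [nhds_prod_eq, mem_prod_iff] at hnhds
  obtain ⟨A, hA, B, hB, hAB⟩ := hnhds
  have hAinf := infinite_of_mem_nhds z₀.re hA
  have hBinf := infinite_of_mem_nhds z₀.im hB
  refine MvPolynomial.funext_set ![Complex.ofReal '' A, Complex.ofReal '' B] ?_ ?_
  · intro i
    fin_cases i
    · exact hAinf.image Complex.ofReal_injective.injOn
    · exact hBinf.image Complex.ofReal_injective.injOn
  · intro y hy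
    have h0 := hy 0 (mem_univ _)
    have h1 := hy 1 (mem_univ _)
    simp only [Matrix.cons_val_zero, Matrix.cons_val_one, Matrix.cons_val_fin_one] at h0 h1
    obtain ⟨a, ha, hay⟩ := h0
    obtain ⟨b, hb, hby⟩ := h1
    have hz := hp _ (hAB (show (a, b) ∈ A ×ˢ B from ⟨ha, hb⟩))
    rw [map_zero, ← hz, htoReal, MvPolynomial.bind₁, evalConj, MvPolynomial.aeval_def,
      MvPolynomial.algebraMap_eq]
    rw [← MvPolynomial.coe_eval₂Hom, ← RingHom.comp_apply]
    congr 1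
    apply MvPolynomial.ringHom_ext
    · intro c; simp
    · intro i
      fin_cases i
      · simp [← hay, ← hby]
      · simp [← hay, ← hby, sub_eq_add_neg]

/-- The antiderivative of a polynomial with respect to the `i`-th variable. -/
def antideriv {σ : Type*} (i : σ) : MvPolynomial σ ℂ →ₗ[ℂ] MvPolynomial σ ℂ :=
  (MvPolynomial.basisMonomials σ ℂ).constr ℂ
    fun m => MvPolynomial.monomial (m + Finsupp.single i 1) ((m i + 1 : ℂ)⁻¹)

theorem antideriv_monomial {σ : Type*} (i : σ) (m : σ →₀ ℕ) (a : ℂ) :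
    antideriv i (MvPolynomial.monomial m a) =
      MvPolynomial.monomial (m + Finsupp.single i 1) (a * (m i + 1 : ℂ)⁻¹) := by
  have h1 : MvPolynomial.monomial m a = a • MvPolynomial.basisMonomials σ ℂ m := by
    simp [MvPolynomial.smul_monomial]
  rw [h1, map_smul, antideriv, Module.Basis.constr_basis, MvPolynomial.smul_monomial,
    smul_eq_mul]

theorem pderiv_antideriv {σ : Type*} (i : σ) (p : MvPolynomial σ ℂ) :
    MvPolynomial.pderiv i (antideriv i p) = p := by
  induction p using MvPolynomial.induction_on' with
  | monomial m a =>
    rw [antideriv_monomial, MvPolynomial.pderiv_monomial, add_tsub_cancel_right]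
    congr 1
    have : (m i + 1 : ℂ) ≠ 0 := Nat.cast_add_one_ne_zero _
    simp [this]
  | add p q hp hq => rw [map_add, map_add, hp, hq]

theorem pderiv_antideriv_of_ne {σ : Type*} {i j : σ} (hij : j ≠ i) (p : MvPolynomial σ ℂ) :
    MvPolynomial.pderiv j (antideriv i p) = antideriv i (MvPolynomial.pderiv j p) := by
  classical
  induction p using MvPolynomial.induction_on' with
  | monomial m a =>
    rw [antideriv_monomial, MvPolynomial.pderiv_monomial, MvPolynomial.pderiv_monomial,
      antideriv_monomial]
    by_cases hm : m j = 0
    · simp [hm, hij.symm, hij]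
    · have hexp : m + Finsupp.single i 1 - Finsupp.single j 1 =
          m - Finsupp.single j 1 + Finsupp.single i 1 := by
        ext k
        by_cases h1 : j = k
        · subst h1
          simp [hij]
        · simp [Finsupp.single_apply, h1]
      rw [hexp]
      congr 1
      simp [hij, hij.symm]
      ring
  | add p q hp hq => rw [map_add, map_add, map_add, map_add, hp, hq]

section Wirtinger

variable {X : Set ℂ}

/-- The complex functions that are smooth on `X`, extended by zero. -/
def smoothFunctions (X : Set ℂ) : Submodule ℂ (ℂ → ℂ) where
  carrier := {F | ContDiffOn ℝ ∞ F X ∧ ∀ x ∉ X, F x = 0}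
  add_mem' := fun hF hG => ⟨hF.1.add hG.1, fun x hx => by simp [hF.2 x hx, hG.2 x hx]⟩
  zero_mem' := ⟨contDiffOn_const, fun _ _ => rfl⟩
  smul_mem' := fun c F hF => ⟨contDiffOn_const.mul hF.1, fun x hx => by simp [hF.2 x hx]⟩

/-- The first order differential operator `a ∂ₓ + b ∂ᵧ` with constant complex coefficients. -/
def constCoeffOp (hX : IsOpen X) (a b : ℂ) : Module.End ℂ (smoothFunctions X) where
  toFun F := ⟨X.indicator fun x => a * fderiv ℝ F.1 x 1 + b * fderiv ℝ F.1 x Complex.I, by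
    refine ⟨ContDiffOn.congr ?_ fun x hx => indicator_of_mem hx _,
      fun x hx => indicator_of_notMem hx _⟩
    have h1 := F.2.1.fderiv_of_isOpen hX (m := ∞) (by simp)
    exact (contDiffOn_const.mul (h1.clm_apply contDiffOn_const)).add
      (contDiffOn_const.mul (h1.clm_apply contDiffOn_const))⟩
  map_add' F G := by
    ext x
    by_cases hx : x ∈ X
    · have hF := ((F.2.1.contDiffAt (hX.mem_nhds hx)).differentiableAt (by simp))
      have hG := ((G.2.1.contDiffAt (hX.mem_nhds hx)).differentiableAt (by simp))
      simp only [Submodule.coe_add, indicator_of_mem hx, Pi.add_apply]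
      rw [fderiv_add hF hG]
      simp only [add_apply]
      ring
    · simp [indicator_of_notMem hx]
  map_smul' c F := by
    ext x
    by_cases hx : x ∈ X
    · have hF := ((F.2.1.contDiffAt (hX.mem_nhds hx)).differentiableAt (by simp))
      simp only [Submodule.coe_smul, indicator_of_mem hx, Pi.smul_apply, RingHom.id_apply]
      rw [fderiv_const_smul hF]
      simp only [smul_apply, smul_eq_mul]
      ring
    · simp [indicator_of_notMem hx]

theorem constCoeffOp_apply (hX : IsOpen X) (a b : ℂ) (F : smoothFunctions X) {x : ℂ}
    (hx : x ∈ X) :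
    (constCoeffOp hX a b F).1 x = a * fderiv ℝ F.1 x 1 + b * fderiv ℝ F.1 x Complex.I :=
  indicator_of_mem hx (fun x => a * fderiv ℝ F.1 x 1 + b * fderiv ℝ F.1 x Complex.I)

theorem commute_constCoeffOp (hX : IsOpen X) (a b c d : ℂ) :
    Commute (constCoeffOp hX a b) (constCoeffOp hX c d) := by
  have key : ∀ (a b c d : ℂ) (F : smoothFunctions X), ∀ x ∈ X,
      (constCoeffOp hX a b (constCoeffOp hX c d F)).1 x =
        a * (c * fderiv ℝ (fderiv ℝ F.1) x 1 1 + d * fderiv ℝ (fderiv ℝ F.1) x 1 Complex.I) +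
        b * (c * fderiv ℝ (fderiv ℝ F.1) x Complex.I 1 +
          d * fderiv ℝ (fderiv ℝ F.1) x Complex.I Complex.I) := by
    intro a b c d F x hx
    have h1 : DifferentiableAt ℝ (fderiv ℝ F.1) x :=
      ((F.2.1.fderiv_of_isOpen hX (m := ∞) (by simp)).contDiffAt
        (hX.mem_nhds hx)).differentiableAt (by simp)
    have h2 : (constCoeffOp hX c d F).1 =ᶠ[𝓝 x]
        fun y => c * fderiv ℝ F.1 y 1 + d * fderiv ℝ F.1 y Complex.I := by
      filter_upwards [hX.mem_nhds hx] with y hy using constCoeffOp_apply hX c d F hy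
    have h3 : ∀ u : ℂ, HasFDerivAt (fun y => fderiv ℝ F.1 y u)
        ((fderiv ℝ (fderiv ℝ F.1) x).flip u) x := fun u =>
      h1.hasFDerivAt.clm_apply (hasFDerivAt_const u x) |>.congr_fderiv (by ext; simp)
    have h4 : HasFDerivAt (constCoeffOp hX c d F).1 _ x :=
      (((h3 1).const_mul c).add ((h3 Complex.I).const_mul d)).congr_of_eventuallyEq h2
    rw [constCoeffOp_apply hX a b _ hx, h4.fderiv]
    simp
  ext F x
  by_cases hx : x ∈ X
  · have hsymm : IsSymmSndFDerivAt ℝ F.1 x :=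
      (F.2.1.contDiffAt (hX.mem_nhds hx)).isSymmSndFDerivAt (by
      rw [minSmoothness_of_isRCLikeNormedField]
      exact WithTop.coe_le_coe.2 (le_top : (2 : ℕ∞) ≤ ⊤))
    have := hsymm 1 Complex.I
    simp only [Module.End.mul_apply]
    rw [key a b c d F x hx, key c d a b F x hx, this]
    ring
  · simp only [Module.End.mul_apply]
    rw [(constCoeffOp hX a b (constCoeffOp hX c d F)).2.2 x hx,
      (constCoeffOp hX c d (constCoeffOp hX a b F)).2.2 x hx]

/-- The Wirtinger derivative `∂`. -/
def wirtinger (hX : IsOpen X) : Module.End ℂ (smoothFunctions X) :=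
  constCoeffOp hX (1 / 2) (-Complex.I / 2)

/-- The Wirtinger derivative `∂̄`. -/
def wirtingerBar (hX : IsOpen X) : Module.End ℂ (smoothFunctions X) :=
  constCoeffOp hX (1 / 2) (Complex.I / 2)

theorem fderiv_eq_wirtinger (hX : IsOpen X) (F : smoothFunctions X) {x : ℂ} (hx : x ∈ X) (v : ℂ) :
    fderiv ℝ F.1 x v =
      (wirtinger hX F).1 x * v + (wirtingerBar hX F).1 x * (starRingEnd ℂ) v := by
  have hv : v = v.re • (1 : ℂ) + v.im • Complex.I := by simp [Complex.re_add_im]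
  have hvc : (starRingEnd ℂ) v = v.re - v.im * Complex.I := by
    apply Complex.ext <;> simp
  have h1 : fderiv ℝ F.1 x v = v.re * fderiv ℝ F.1 x 1 + v.im * fderiv ℝ F.1 x Complex.I := by
    conv_lhs => rw [hv]
    rw [map_add, map_smul, map_smul, Complex.real_smul, Complex.real_smul]
  rw [hvc, h1, wirtinger, wirtingerBar, constCoeffOp_apply hX _ _ F hx,
    constCoeffOp_apply hX _ _ F hx]
  conv_rhs => rw [← Complex.re_add_im v]
  have := Complex.I_mul_I
  simp only [Complex.add_re, Complex.mul_re, Complex.ofReal_re, Complex.ofReal_im, Complex.I_re,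
    Complex.I_im, Complex.add_im, Complex.mul_im]
  push_cast
  linear_combination ((v.im : ℂ) * fderiv ℝ F.1 x Complex.I) * this

/-- `F` agrees on `X` with a polynomial in `z` and `z̄`. -/
def IsConjPolynomialOn (X : Set ℂ) (F : ℂ → ℂ) : Prop :=
  ∃ p : MvPolynomial (Fin 2) ℂ, ∀ x ∈ X, F x = evalConj p x

/-- A function whose Wirtinger derivatives are polynomials is a polynomial. -/
theorem isConjPolynomialOn_of_wirtinger (hX : IsOpen X) (hXc : IsPreconnected X)
    (F : smoothFunctions X) (h : IsConjPolynomialOn X (wirtinger hX F).1)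
    (hbar : IsConjPolynomialOn X (wirtingerBar hX F).1) : IsConjPolynomialOn X F.1 := by
  rcases X.eq_empty_or_nonempty with rfl | hne
  · exact ⟨0, fun x hx => hx.elim⟩
  obtain ⟨p, hp⟩ := h
  obtain ⟨q, hq⟩ := hbar
  have hfd : ∀ x ∈ X, ∀ v, fderiv ℝ F.1 x v = evalConj p x * v +
      evalConj q x * (starRingEnd ℂ) v := by
    intro x hx v
    rw [fderiv_eq_wirtinger hX F hx, hp x hx, hq x hx]
  -- Equality of the mixed derivatives makes `(p, q)` a closed form.
  have hclosed : MvPolynomial.pderiv 1 p = MvPolynomial.pderiv 0 q := by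
    rw [← sub_eq_zero]
    refine eq_zero_of_evalConj_eq_zero hX hne fun x hx => ?_
    have hsymm : IsSymmSndFDerivAt ℝ F.1 x :=
      (F.2.1.contDiffAt (hX.mem_nhds hx)).isSymmSndFDerivAt (by
      rw [minSmoothness_of_isRCLikeNormedField]
      exact WithTop.coe_le_coe.2 (le_top : (2 : ℕ∞) ≤ ⊤))
    have hdiff : ∀ p, HasFDerivAt (evalConj p) (fderiv ℝ (evalConj p) x) x := fun p =>
      ((contDiff_evalConj p).differentiable (by simp) x).hasFDerivAt
    have h1 : DifferentiableAt ℝ (fderiv ℝ F.1) x :=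
      ((F.2.1.fderiv_of_isOpen hX (m := ∞) (by simp)).contDiffAt
        (hX.mem_nhds hx)).differentiableAt (by simp)
    have h3 : ∀ u v : ℂ, fderiv ℝ (fderiv ℝ F.1) x u v =
        fderiv ℝ (evalConj p) x u * v + fderiv ℝ (evalConj q) x u * (starRingEnd ℂ) v := by
      intro u v
      have e1 : HasFDerivAt (fun y => fderiv ℝ F.1 y v)
          ((fderiv ℝ (fderiv ℝ F.1) x).flip v) x :=
        h1.hasFDerivAt.clm_apply (hasFDerivAt_const v x) |>.congr_fderiv (by ext; simp)
      have e2 : (fun y => fderiv ℝ F.1 y v) =ᶠ[𝓝 x]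
          fun y => evalConj p y * v + evalConj q y * (starRingEnd ℂ) v := by
        filter_upwards [hX.mem_nhds hx] with y hy using hfd y hy v
      have e3 := (((hdiff p).mul_const v).add ((hdiff q).mul_const ((starRingEnd ℂ) v)))
      have := congrArg (fun l => l u) (e1.unique (e3.congr_of_eventuallyEq e2))
      simpa [mul_comm] using this
    have := hsymm 1 Complex.I
    rw [h3, h3, fderiv_evalConj, fderiv_evalConj, fderiv_evalConj, fderiv_evalConj] at this
    simp only [map_one, Complex.conj_I] at this
    have e : evalConj (MvPolynomial.pderiv 1 p - MvPolynomial.pderiv 0 q) x =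
        evalConj (MvPolynomial.pderiv 1 p) x - evalConj (MvPolynomial.pderiv 0 q) x := by
      simp [evalConj]
    rw [e]
    have h2 : (2 * Complex.I) * (evalConj (MvPolynomial.pderiv 1 p) x -
      evalConj (MvPolynomial.pderiv 0 q) x) = 0 := by linear_combination this
    exact (mul_eq_zero.1 h2).resolve_left (by simp)
  -- An antiderivative of `p dz + q dz̄`.
  set R₀ := antideriv 0 p
  set R₁ := antideriv 1 (q - MvPolynomial.pderiv 1 R₀)
  have hR0 : MvPolynomial.pderiv 0 (R₀ + R₁) = p := by
    rw [map_add, pderiv_antideriv, pderiv_antideriv_of_ne (by decide), map_sub,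
      pderiv_antideriv_of_ne (by decide), pderiv_antideriv, hclosed, sub_self, map_zero, add_zero]
  have hR1 : MvPolynomial.pderiv 1 (R₀ + R₁) = q := by
    rw [map_add, pderiv_antideriv]; ring
  obtain ⟨x₀, hx₀⟩ := hne
  have hconst : ∀ x ∈ X, F.1 x - evalConj (R₀ + R₁) x = F.1 x₀ - evalConj (R₀ + R₁) x₀ := by
    intro x hx
    have hF : ∀ y ∈ X, DifferentiableAt ℝ F.1 y := fun y hy =>
      (F.2.1.contDiffAt (hX.mem_nhds hy)).differentiableAt (by simp)
    have hR : Differentiable ℝ (evalConj (R₀ + R₁)) :=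
      (contDiff_evalConj _).differentiable (by simp)
    refine hX.is_const_of_fderiv_eq_zero (𝕜 := ℝ) (f := fun y => F.1 y - evalConj (R₀ + R₁) y)
      hXc (fun y hy => ((hF y hy).sub (hR y)).differentiableWithinAt) ?_ hx hx₀
    intro y hy
    ext v
    rw [fderiv_fun_sub (hF y hy) (hR y)]
    simp only [sub_apply, Pi.zero_apply, zero_apply]
    rw [hfd y hy, fderiv_evalConj, hR0, hR1, sub_self]
  refine ⟨R₀ + R₁ + MvPolynomial.C (F.1 x₀ - evalConj (R₀ + R₁) x₀), fun x hx => ?_⟩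
  have h1 := hconst x hx
  have h2 : evalConj (R₀ + R₁ + MvPolynomial.C (F.1 x₀ - evalConj (R₀ + R₁) x₀)) x =
      evalConj (R₀ + R₁) x + (F.1 x₀ - evalConj (R₀ + R₁) x₀) := by
    rw [evalConj, map_add, MvPolynomial.eval_C]; rfl
  rw [h2]
  linear_combination h1

/-- A function annihilated by powers of both Wirtinger derivatives is a polynomial. -/
theorem isConjPolynomialOn_of_pow_wirtinger (hX : IsOpen X) (hXc : IsPreconnected X)
    (n m : ℕ) (F : smoothFunctions X) (h : (wirtinger hX ^ n) F = 0)
    (hbar : (wirtingerBar hX ^ m) F = 0) : IsConjPolynomialOn X F.1 := by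
  induction hk : n + m generalizing n m F with
  | zero =>
    obtain rfl : n = 0 := by omega
    have : F = 0 := by simpa using h
    exact ⟨0, fun x _ => by simp [this, evalConj]⟩
  | succ k ih =>
    have hcomm : Commute (wirtinger hX) (wirtingerBar hX) := commute_constCoeffOp hX _ _ _ _
    rcases Nat.eq_zero_or_pos n with rfl | hn
    · have : F = 0 := by simpa using h
      exact ⟨0, fun x _ => by simp [this, evalConj]⟩
    rcases Nat.eq_zero_or_pos m with rfl | hm
    · have : F = 0 := by simpa using hbar
      exact ⟨0, fun x _ => by simp [this, evalConj]⟩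
    obtain ⟨n, rfl⟩ := Nat.exists_eq_succ_of_ne_zero hn.ne'
    obtain ⟨m, rfl⟩ := Nat.exists_eq_succ_of_ne_zero hm.ne'
    refine isConjPolynomialOn_of_wirtinger hX hXc F ?_ ?_
    · refine ih n (m + 1) (wirtinger hX F) ?_ ?_ (by omega)
      · rwa [← Module.End.mul_apply, ← pow_succ]
      · rw [← Module.End.mul_apply, ← (hcomm.pow_right _).eq, Module.End.mul_apply, hbar, map_zero]
    · refine ih (n + 1) m (wirtingerBar hX F) ?_ ?_ (by omega)
      · rw [← Module.End.mul_apply, (hcomm.pow_left _).eq, Module.End.mul_apply, h, map_zero]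
      · rwa [← Module.End.mul_apply, ← pow_succ]

end Wirtinger

/-! ### Polynomial integrals are polynomials of the Larmor centre -/

/-- On unit vectors, a polynomial in momenta of degree `N` is `v⁻ᴺ` times a polynomial in `v` of
degree at most `2N`. -/
theorem exists_coeff_polyInMomenta {K : Set ℂ} {N : ℕ} {a : ℕ → ℕ → ℂ → ℝ}
    (ha : ∀ k l, k + l ≤ N → ContDiffOn ℝ ∞ (a k l) K) :
    ∃ B : ℕ → ℂ → ℂ, (∀ j, ContDiffOn ℝ ∞ (B j) K) ∧ (∀ j, 2 * N < j → B j = 0) ∧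
      ∀ x v : ℂ, ‖v‖ = 1 → v ^ N * (polyInMomenta N a x v : ℂ) =
        ∑ j ∈ Finset.range (2 * N + 1), B j x * v ^ j := by
  -- `T k l` represents `vᴺ v₁ᵏ v₂ˡ`, since `v v₁ = (v² + 1) / 2` and `v v₂ = (v² - 1) / 2i`.
  set T : ℕ → ℕ → Polynomial ℂ := fun k l => Polynomial.X ^ (N - k - l) *
    (Polynomial.C (1 / 2) * (Polynomial.X ^ 2 + 1)) ^ k *
    (Polynomial.C (1 / (2 * Complex.I)) * (Polynomial.X ^ 2 - 1)) ^ l with hT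
  have hdeg : ∀ k l, k + l ≤ N → (T k l).natDegree < 2 * N + 1 := by
    intro k l hkl
    have h1 : (Polynomial.C (1 / 2 : ℂ) * (Polynomial.X ^ 2 + 1)).natDegree ≤ 2 := by
      compute_degree
    have h2 : (Polynomial.C (1 / (2 * Complex.I) : ℂ) *
        (Polynomial.X ^ 2 - 1)).natDegree ≤ 2 := by
      compute_degree
    have h3 : (T k l).natDegree ≤ (N - k - l) + k * 2 + l * 2 := by
      refine Polynomial.natDegree_mul_le_of_le (Polynomial.natDegree_mul_le_of_le ?_ ?_) ?_
      · simp
      · exact Polynomial.natDegree_pow_le_of_le _ h1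
      · exact Polynomial.natDegree_pow_le_of_le _ h2
    omega
  have heval : ∀ k l, k + l ≤ N → ∀ v : ℂ, ‖v‖ = 1 →
      (T k l).eval v = v ^ N * ((v.re : ℂ) ^ k * (v.im : ℂ) ^ l) := by
    intro k l hkl v hv
    have hvv := mul_conj_eq_one hv
    have hre : (1 / 2 : ℂ) * (v ^ 2 + 1) = v * v.re := by
      rw [Complex.re_eq_add_conj]
      linear_combination (-1 / 2 : ℂ) * hvv
    have him : (1 / (2 * Complex.I) : ℂ) * (v ^ 2 - 1) = v * v.im := by
      rw [Complex.im_eq_sub_conj]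
      field_simp
      linear_combination hvv
    simp only [hT, Polynomial.eval_mul, Polynomial.eval_pow, Polynomial.eval_X,
      Polynomial.eval_C, Polynomial.eval_add, Polynomial.eval_sub, Polynomial.eval_one]
    rw [hre, him, mul_pow, mul_pow]
    have hN : v ^ N = v ^ (N - k - l) * v ^ k * v ^ l := by
      rw [← pow_add, ← pow_add]; congr 1; omega
    rw [hN]; ring
  refine ⟨fun j x => ∑ k ∈ Finset.range (N + 1), ∑ l ∈ Finset.range (N + 1 - k),
    (a k l x : ℂ) * (T k l).coeff j, ?_, ?_, ?_⟩
  · intro j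
    refine ContDiffOn.sum fun k hk => ContDiffOn.sum fun l hl => ?_
    rw [Finset.mem_range] at hk hl
    exact (Complex.ofRealCLM.contDiff.comp_contDiffOn (ha k l (by omega))).mul contDiffOn_const
  · intro j hj
    funext x
    refine Finset.sum_eq_zero fun k hk => Finset.sum_eq_zero fun l hl => ?_
    rw [Finset.mem_range] at hk hl
    rw [Polynomial.coeff_eq_zero_of_natDegree_lt (by have := hdeg k l (by omega); omega), mul_zero]
  · intro x v hv
    simp only [Finset.sum_mul]
    rw [Finset.sum_comm, polyInMomenta]
    push_cast
    rw [Finset.mul_sum]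
    refine Finset.sum_congr rfl fun k hk => ?_
    rw [Finset.sum_comm, Finset.mul_sum]
    refine Finset.sum_congr rfl fun l hl => ?_
    rw [Finset.mem_range] at hk hl
    have h1 := heval k l (by omega) v hv
    rw [Polynomial.eval_eq_sum_range' (hdeg k l (by omega))] at h1
    simp only [mul_assoc]
    rw [← Finset.mul_sum, h1]
    ring

theorem larmorRadius_mul {β : ℝ} (hβ : β ≠ 0) : (larmorRadius β : ℂ) * β = 1 := by
  rw [larmorRadius]
  exact_mod_cast one_div_mul_cancel hβ

theorem hasDerivAt_velocity (β : ℝ) (v : ℂ) (t : ℝ) :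
    HasDerivAt (velocity β v) (Complex.I * β * velocity β v t) t := by
  have h1 : HasDerivAt (fun t : ℝ => ((β * t : ℝ) : ℂ) * Complex.I) (β * Complex.I) t := by
    have := (((hasDerivAt_id t).const_mul β).ofReal_comp).mul_const Complex.I
    simpa using this
  have h2 := (h1.cexp).mul_const v
  refine h2.congr_deriv ?_
  simp only [velocity]
  ring

theorem hasDerivAt_position {β : ℝ} (hβ : β ≠ 0) (x v : ℂ) (t : ℝ) :
    HasDerivAt (position β x v) (velocity β v t) t := by
  have h1 := (((hasDerivAt_velocity β v t).const_mul Complex.I).const_smul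
    (larmorRadius β)).const_sub (x + larmorRadius β • (Complex.I * v))
  refine h1.congr_deriv ?_
  have hr := larmorRadius_mul hβ
  rw [Complex.real_smul]
  linear_combination (-(larmorRadius β : ℂ) * β * velocity β v t) * Complex.I_mul_I +
    velocity β v t * hr

theorem hasDerivAt_velocity_pow (β : ℝ) (v : ℂ) (t : ℝ) (j : ℕ) :
    HasDerivAt (fun t => velocity β v t ^ j) (Complex.I * β * j * velocity β v t ^ j) t := by
  refine ((hasDerivAt_velocity β v t).pow j).congr_deriv ?_
  rcases j with _ | j
  · simp
  · simp only [Nat.add_sub_cancel, pow_succ]; ring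

/-- The transport equation at a point, if it holds for infinitely many velocities, holds
coefficientwise. -/
theorem transport_coeff {M : ℕ} {D E C : ℕ → ℂ} (hD : ∀ j, M ≤ j → D j = 0)
    (hE : ∀ j, M ≤ j → E j = 0) (hC : ∀ j, M ≤ j → C j = 0) {S : Set ℂ} (hS : S.Infinite)
    (h : ∀ w ∈ S, ∑ j ∈ Finset.range M,
      (D j * w ^ (j + 2) + E j * w ^ j + C j * w ^ (j + 1)) = 0) :
    (∀ w, ∑ j ∈ Finset.range M,
      (D j * w ^ (j + 2) + E j * w ^ j + C j * w ^ (j + 1)) = 0) ∧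
    E 0 = 0 ∧ E 1 + C 0 = 0 ∧ ∀ j, D j + E (j + 2) + C (j + 1) = 0 := by
  set p : Polynomial ℂ := ∑ j ∈ Finset.range M, (Polynomial.monomial (j + 2) (D j) +
    Polynomial.monomial j (E j) + Polynomial.monomial (j + 1) (C j)) with hp
  have heval : ∀ w, p.eval w = ∑ j ∈ Finset.range M,
      (D j * w ^ (j + 2) + E j * w ^ j + C j * w ^ (j + 1)) := by
    intro w
    simp [hp, Polynomial.eval_finsetSum, Polynomial.eval_monomial]
  have hp0 : p = 0 := by
    refine Polynomial.eq_zero_of_infinite_isRoot p (hS.mono fun w hw => ?_)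
    rw [mem_ofPred_eq, Polynomial.IsRoot, heval, h w hw]
  refine ⟨fun w => by rw [← heval, hp0, Polynomial.eval_zero], ?_⟩
  have hcoeff : ∀ n, ∑ j ∈ Finset.range M, ((if j + 2 = n then D j else 0) +
      (if j = n then E j else 0) + (if j + 1 = n then C j else 0)) = 0 := by
    intro n
    have := congrArg (fun q => Polynomial.coeff q n) hp0
    simpa [hp, Polynomial.finsetSum_coeff, Polynomial.coeff_monomial] using this
  have hpick : ∀ (F : ℕ → ℂ), (∀ j, M ≤ j → F j = 0) → ∀ n,
      ∑ j ∈ Finset.range M, (if j = n then F j else 0) = F n := by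
    intro F hF n
    rw [Finset.sum_ite_eq' (Finset.range M) n F]
    split_ifs with hn
    · rfl
    · rw [hF n (by simpa using hn)]
  refine ⟨?_, ?_, ?_⟩
  · have := hcoeff 0
    simpa [hpick E hE] using this
  · have := hcoeff 1
    simp only [Finset.sum_add_distrib, hpick E hE] at this
    have h2 : ∀ j, ¬ (j + 2 = 1) := by omega
    have h3 : ∀ j, j + 1 = 1 ↔ j = 0 := by omega
    simp only [h2, h3, if_false, Finset.sum_const_zero, zero_add] at this
    rwa [hpick C hC] at this
  · intro j
    have := hcoeff (j + 2)
    simp only [Finset.sum_add_distrib, hpick E hE, Nat.add_right_cancel_iff] at this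
    rwa [hpick D hD, hpick C hC] at this

section

variable {Ω : Set ℂ} {γ : ℝ → ℂ} {L : ℝ}

/-- The derivative of the integral along an arc ending at `x` with velocity `w` vanishes. -/
theorem IsPolynomialIntegral.transport {β : ℝ} (hβ : 0 < β)
    {Φ : ℂ → ℂ → ℝ} (hΦ : IsPolynomialIntegral Ω γ β Φ) {X : Set ℂ} (hX : IsOpen X)
    {N M : ℕ} (F : ℕ → smoothFunctions X)
    (hF : ∀ x ∈ X, ∀ v : ℂ, ‖v‖ = 1 →
      v ^ N * (Φ x v : ℂ) = ∑ j ∈ Finset.range M, (F j).1 x * v ^ j)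
    {x w : ℂ} (hx : x ∈ X) (hw : w ∈ arrivalVelocities Ω γ β x) :
    ∑ j ∈ Finset.range M, ((wirtinger hX (F j)).1 x * w ^ (j + 2) +
      (wirtingerBar hX (F j)).1 x * w ^ j +
      (Complex.I * β * ((j : ℂ) - N) * (F j).1 x) * w ^ (j + 1)) = 0 := by
  obtain ⟨s, v, τ, hv, hin, hτ, hpos, hvel, hΩ⟩ := hw
  have hw1 : ‖w‖ = 1 := by rw [← hvel, norm_velocity, hv]
  set c : ℂ := (Φ (γ s) v : ℂ) with hc
  have hpc : ContinuousAt (position β x w) 0 := (hasDerivAt_position hβ.ne' x w 0).continuousAt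
  have hX0 : ∀ᶠ σ in 𝓝 (0 : ℝ), position β x w σ ∈ X :=
    hpc.preimage_mem_nhds (by rw [position_zero]; exact hX.mem_nhds hx)
  -- Only the part of the arc before `x` is known to lie in `Ω`, whence one-sided derivatives.
  have heq : ∀ᶠ σ in 𝓝[≤] (0 : ℝ), ∑ j ∈ Finset.range M,
      (F j).1 (position β x w σ) * velocity β w σ ^ j = velocity β w σ ^ N * c := by
    have h1 : ∀ᶠ σ in 𝓝[≤] (0 : ℝ), -τ < σ :=
      mem_nhdsWithin_of_mem_nhds (Ioi_mem_nhds (by linarith))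
    filter_upwards [mem_nhdsWithin_of_mem_nhds hX0, h1, self_mem_nhdsWithin] with σ hσX hσ hσ0
    rw [← hF _ hσX _ (by rw [norm_velocity, hw1])]
    congr 1
    rw [hc, ← hpos, ← hvel, ← position_add, ← velocity_add]
    have hσ0' : σ ≤ 0 := hσ0
    exact congrArg _ (hΦ.flow s v hv hin (τ + σ) (by linarith)
      fun u hu => hΩ u ⟨hu.1, by linarith [hu.2]⟩)
  have hd1 : HasDerivAt (fun σ => ∑ j ∈ Finset.range M,
      (F j).1 (position β x w σ) * velocity β w σ ^ j)
      (∑ j ∈ Finset.range M, (fderiv ℝ (F j).1 x w * w ^ j +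
        (F j).1 x * (Complex.I * β * j * w ^ j))) 0 := by
    refine HasDerivAt.fun_sum fun j _ => ?_
    have e1 : HasFDerivAt (F j).1 (fderiv ℝ (F j).1 x) (position β x w 0) := by
      rw [position_zero]
      exact (((F j).2.1.contDiffAt (hX.mem_nhds hx)).differentiableAt (by simp)).hasFDerivAt
    have e2 := e1.comp_hasDerivAt (0 : ℝ) (hasDerivAt_position hβ.ne' x w 0)
    have e3 := e2.mul (hasDerivAt_velocity_pow β w 0 j)
    refine HasDerivAt.congr_deriv e3 ?_
    simp [position_zero, velocity_zero]
  have hd2 : HasDerivAt (fun σ => velocity β w σ ^ N * c) (Complex.I * β * N * w ^ N * c) 0 := by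
    simpa [velocity_zero] using (hasDerivAt_velocity_pow β w 0 N).mul_const c
  have huniq := (uniqueDiffWithinAt_Iic (0 : ℝ)).eq_deriv _ hd1.hasDerivWithinAt
    (hd2.hasDerivWithinAt.congr_of_eventuallyEq heq (heq.self_of_nhdsWithin self_mem_Iic))
  have hval : w ^ N * c = ∑ j ∈ Finset.range M, (F j).1 x * w ^ j := by
    have := heq.self_of_nhdsWithin self_mem_Iic
    simpa [position_zero, velocity_zero] using this.symm
  have hww := mul_conj_eq_one hw1
  have h2 : Complex.I * β * N * w ^ N * c =
      ∑ j ∈ Finset.range M, Complex.I * β * N * ((F j).1 x * w ^ j) := by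
    rw [← Finset.mul_sum, ← hval]; ring
  rw [h2, ← sub_eq_zero, ← Finset.sum_sub_distrib] at huniq
  have h3 := congrArg (fun z => w * z) huniq
  simp only [mul_zero, Finset.mul_sum] at h3
  rw [← h3]
  refine Finset.sum_congr rfl fun j _ => ?_
  rw [fderiv_eq_wirtinger hX (F j) hx]
  linear_combination (-(wirtingerBar hX (F j)).1 x * w ^ j) * hww

/-- The transport equations force the coefficients to be polynomials: going up from `j = 0` they
give `∂̄ʲ⁺¹ Fⱼ = 0`, and going down from `j = M` they give `∂ᴹ⁻ʲ Fⱼ = 0`. -/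
theorem isConjPolynomialOn_of_transport {X : Set ℂ} (hX : IsOpen X) (hXc : IsPreconnected X)
    {M : ℕ} (F : ℕ → smoothFunctions X) (c : ℕ → ℂ) (hM : ∀ j, M ≤ j → F j = 0)
    (h0 : wirtingerBar hX (F 0) = 0) (h1 : wirtingerBar hX (F 1) + c 0 • F 0 = 0)
    (h2 : ∀ j, wirtinger hX (F j) + wirtingerBar hX (F (j + 2)) + c (j + 1) • F (j + 1) = 0)
    (j : ℕ) : IsConjPolynomialOn X (F j).1 := by
  have hcomm : Commute (wirtinger hX) (wirtingerBar hX) := commute_constCoeffOp hX _ _ _ _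
  have hbar : ∀ i j, j < i → (wirtingerBar hX ^ i) (F j) = 0 := by
    intro i
    induction i with
    | zero => intro j hj; omega
    | succ i ih =>
      intro j hj
      rw [pow_succ, Module.End.mul_apply]
      rcases j with _ | _ | j
      · rw [h0, map_zero]
      · rw [eq_neg_of_add_eq_zero_left h1, map_neg, map_smul, ih 0 (by omega), smul_zero, neg_zero]
      · have : wirtingerBar hX (F (j + 2)) = -(wirtinger hX (F j)) - c (j + 1) • F (j + 1) := by
          rw [← sub_eq_zero, ← h2 j]; abel
        rw [this, map_sub, map_neg, map_smul, ih (j + 1) (by omega), ← Module.End.mul_apply,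
          ← (hcomm.pow_right i).eq, Module.End.mul_apply, ih j (by omega)]
        simp
  have hdir : ∀ i j, M ≤ j + i → (wirtinger hX ^ i) (F j) = 0 := by
    intro i
    induction i with
    | zero => intro j hj; rw [hM j (by omega), map_zero]
    | succ i ih =>
      intro j hj
      have : wirtinger hX (F j) = -(wirtingerBar hX (F (j + 2))) - c (j + 1) • F (j + 1) := by
        rw [← sub_eq_zero, ← h2 j]; abel
      rw [pow_succ, Module.End.mul_apply, this, map_sub, map_neg, map_smul, ih (j + 1) (by omega),
        ← Module.End.mul_apply, (hcomm.pow_left i).eq, Module.End.mul_apply, ih (j + 2) (by omega)]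
      simp
  exact isConjPolynomialOn_of_pow_wirtinger hX hXc M (j + 1) (F j) (hdir M j (by omega))
    (hbar (j + 1) j (by omega))

/-- A family of polynomials satisfying the transport equation is, on unit vectors, a polynomial
of the Larmor centre `x + r J v`. -/
theorem eq_eval_centre_of_transport {β : ℝ} (hβ : β ≠ 0) {N M : ℕ}
    (p : ℕ → MvPolynomial (Fin 2) ℂ)
    (hp : ∀ x w : ℂ, ∑ j ∈ Finset.range M, (evalConj (MvPolynomial.pderiv 0 (p j)) x * w ^ (j + 2) +
      evalConj (MvPolynomial.pderiv 1 (p j)) x * w ^ j +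
      (Complex.I * β * ((j : ℂ) - N) * evalConj (p j) x) * w ^ (j + 1)) = 0) (c : ℂ) {v : ℂ}
    (hv : ‖v‖ = 1) :
    ∑ j ∈ Finset.range M, evalConj (p j) (c - larmorRadius β * Complex.I * v) * v ^ j =
      v ^ N * ∑ j ∈ Finset.range M, evalConj (p j) (c - larmorRadius β * Complex.I) := by
  set r := larmorRadius β with hr
  have hrβ : (r : ℂ) * β = 1 := larmorRadius_mul hβ
  -- Rotate `v` about the fixed centre.
  set rot : ℝ → ℂ := fun θ => Complex.exp (θ * Complex.I) with hrot
  set rot' : ℝ → ℂ := fun θ => Complex.exp (-(θ * Complex.I)) with hrot'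
  have hrotrot : ∀ θ, rot θ * rot' θ = 1 := fun θ => by
    simp only [hrot, hrot']; rw [← Complex.exp_add]; simp
  have hrot0 : ∀ θ, rot θ ≠ 0 := fun θ => Complex.exp_ne_zero _
  have hconj : ∀ θ, (starRingEnd ℂ) (rot θ) = rot' θ := fun θ => by
    simp only [hrot, hrot']; rw [← Complex.exp_conj]; simp
  have hdrot : ∀ θ, HasDerivAt rot (Complex.I * rot θ) θ := fun θ => by
    have h1 : HasDerivAt (fun θ : ℝ => (θ : ℂ) * Complex.I) Complex.I θ := by
      simpa using ((hasDerivAt_id θ).ofReal_comp).mul_const Complex.I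
    exact h1.cexp.congr_deriv (by simp only [hrot]; ring)
  have hdrot' : ∀ θ, HasDerivAt rot' (-Complex.I * rot' θ) θ := fun θ => by
    have h1 : HasDerivAt (fun θ : ℝ => -((θ : ℂ) * Complex.I)) (-Complex.I) θ := by
      simpa using (((hasDerivAt_id θ).ofReal_comp).mul_const Complex.I).fun_neg
    exact h1.cexp.congr_deriv (by simp only [hrot']; ring)
  have hpowrot : ∀ (j : ℕ) θ, HasDerivAt (fun θ => rot θ ^ j) (Complex.I * j * rot θ ^ j) θ := by
    intro j θ
    refine ((hdrot θ).pow j).congr_deriv ?_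
    rcases j with _ | j
    · simp
    · simp only [Nat.add_sub_cancel, pow_succ]; ring
  have hpowrot' : ∀ (j : ℕ) θ,
      HasDerivAt (fun θ => rot' θ ^ j) (-Complex.I * j * rot' θ ^ j) θ := by
    intro j θ
    refine ((hdrot' θ).pow j).congr_deriv ?_
    rcases j with _ | j
    · simp
    · simp only [Nat.add_sub_cancel, pow_succ]; ring
  set G : ℝ → ℂ := fun θ => (∑ j ∈ Finset.range M,
    evalConj (p j) (c - r * Complex.I * rot θ) * rot θ ^ j) * rot' θ ^ N with hG
  have hconjx : ∀ θ, (starRingEnd ℂ) (c - r * Complex.I * rot θ) =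
      (starRingEnd ℂ) c + r * Complex.I * rot' θ := fun θ => by
    rw [map_sub, map_mul, map_mul, hconj, Complex.conj_ofReal, Complex.conj_I]; ring
  have hGd : ∀ θ, HasDerivAt G 0 θ := by
    intro θ
    have h1 : HasDerivAt (fun θ => c - r * Complex.I * rot θ) (r * rot θ) θ :=
      (((hdrot θ).const_mul (r * Complex.I)).const_sub c).congr_deriv (by
        linear_combination (-(r : ℂ) * rot θ) * Complex.I_mul_I)
    have h2 : HasDerivAt (fun θ => (starRingEnd ℂ) c + r * Complex.I * rot' θ) (r * rot' θ) θ :=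
      (((hdrot' θ).const_mul (r * Complex.I)).const_add _).congr_deriv (by
        linear_combination (-(r : ℂ) * rot' θ) * Complex.I_mul_I)
    have h3 : ∀ j, HasDerivAt (fun θ => evalConj (p j) (c - r * Complex.I * rot θ))
        (evalConj (MvPolynomial.pderiv 0 (p j)) (c - r * Complex.I * rot θ) * (r * rot θ) +
        evalConj (MvPolynomial.pderiv 1 (p j)) (c - r * Complex.I * rot θ) * (r * rot' θ)) θ := by
      intro j
      have := hasDerivAt_eval_pair h1 h2 (p j)
      simp only [evalConj, hconjx]
      exact this
    have h4 := (HasDerivAt.fun_sum (u := Finset.range M)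
      fun j _ => (h3 j).mul (hpowrot j θ)).mul (hpowrot' N θ)
    refine h4.congr_deriv ?_
    have h5 := hp (c - r * Complex.I * rot θ) (rot θ)
    have h6 : ∑ j ∈ Finset.range M,
        (evalConj (MvPolynomial.pderiv 0 (p j)) (c - r * Complex.I * rot θ) * (rot θ) ^ (j + 1) +
        evalConj (MvPolynomial.pderiv 1 (p j)) (c - r * Complex.I * rot θ) * (rot' θ) *
          (rot θ) ^ j +
        (Complex.I * β * ((j : ℂ) - N) * evalConj (p j) (c - r * Complex.I * rot θ)) * (rot θ) ^ j)
        = 0 := by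
      have h7 := congrArg (fun z => rot' θ * z) h5
      simp only [mul_zero, Finset.mul_sum] at h7
      rw [← h7]
      refine Finset.sum_congr rfl fun j _ => ?_
      have := hrotrot θ
      rw [pow_succ (rot θ) (j + 1), pow_succ (rot θ) j]
      linear_combination (-(evalConj (MvPolynomial.pderiv 0 (p j)) (c - r * Complex.I * rot θ)) *
        rot θ ^ j * rot θ - (Complex.I * β * ((j : ℂ) - N) *
        evalConj (p j) (c - r * Complex.I * rot θ)) * rot θ ^ j) * this
    have h8 : (∑ j ∈ Finset.range M, ((evalConj (MvPolynomial.pderiv 0 (p j))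
        (c - r * Complex.I * rot θ) * (r * rot θ) +
        evalConj (MvPolynomial.pderiv 1 (p j)) (c - r * Complex.I * rot θ) * (r * rot' θ)) *
          rot θ ^ j +
        evalConj (p j) (c - r * Complex.I * rot θ) * (Complex.I * j * rot θ ^ j))) -
        Complex.I * N * (∑ j ∈ Finset.range M,
          evalConj (p j) (c - r * Complex.I * rot θ) * rot θ ^ j) = 0 := by
      rw [Finset.mul_sum, ← Finset.sum_sub_distrib]
      have h7 := congrArg (fun z => (r : ℂ) * z) h6
      simp only [mul_zero, Finset.mul_sum] at h7
      rw [← h7]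
      refine Finset.sum_congr rfl fun j _ => ?_
      rw [pow_succ (rot θ) j]
      linear_combination (-Complex.I * ((j : ℂ) - N) *
        evalConj (p j) (c - r * Complex.I * rot θ) * rot θ ^ j) * hrβ
    linear_combination (rot' θ ^ N) * h8
  have hconst : ∀ θ, G θ = G 0 := fun θ =>
    is_const_of_deriv_eq_zero (fun θ => (hGd θ).differentiableAt) (fun θ => (hGd θ).deriv) θ 0
  have hvrot : v = rot (Complex.arg v) := by
    have := Complex.norm_mul_exp_arg_mul_I v
    rw [hv] at this
    simpa [hrot] using this.symm
  have h1 := hconst (Complex.arg v)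
  simp only [hG] at h1
  rw [← hvrot] at h1
  have h2 : rot 0 = 1 := by simp [hrot]
  have h3 : rot' 0 = 1 := by simp [hrot']
  rw [h2, h3] at h1
  simp only [one_pow, mul_one] at h1
  rw [← h1]
  have h4 : v ^ N * rot' (Complex.arg v) ^ N = 1 := by
    have h5 := hrotrot (Complex.arg v)
    rw [← hvrot] at h5
    rw [← mul_pow, h5, one_pow]
  linear_combination (-∑ j ∈ Finset.range M, evalConj (p j) (c - r * Complex.I * v) * v ^ j) * h4

/-- A polynomial integral is a polynomial of the Larmor centre. -/
theorem IsPolynomialIntegral.exists_centre_polynomial (h : IsTable Ω γ L) {β ρ : ℝ} (hβ : 0 < β)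
    (hρ : IsTubularRadius γ L ρ) (hβρ : 2 * larmorRadius β < ρ) {Φ : ℂ → ℂ → ℝ}
    (hΦ : IsPolynomialIntegral Ω γ β Φ) :
    ∃ P : MvPolynomial (Fin 2) ℂ, ∀ x ∈ closedAnnulus γ β, ∀ v : ℂ, ‖v‖ = 1 →
      (Φ x v : ℂ) = evalConj P (x + larmorRadius β * Complex.I * v) := by
  obtain ⟨N, a, ha, hΦa⟩ := hΦ.polynomial
  obtain ⟨B, hB, hB0, hBsum⟩ := exists_coeff_polyInMomenta ha
  set X := openAnnulus γ β with hXdef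
  have hX : IsOpen X := hρ.isOpen_openAnnulus h hβρ
  have hXc : IsPreconnected X := h.isPreconnected_openAnnulus β
  have hXsub : X ⊆ closedAnnulus γ β := openAnnulus_subset_closedAnnulus γ β
  have hr := larmorRadius_pos hβ
  have hXne : X.Nonempty := ⟨_, mem_image_of_mem _
    (show ((0 : ℝ), larmorRadius β) ∈ _ from ⟨mem_univ _, hr, by linarith⟩)⟩
  set F : ℕ → smoothFunctions X := fun j => ⟨X.indicator (B j),
    ((hB j).mono hXsub).congr fun x hx => indicator_of_mem hx _,
    fun x hx => indicator_of_notMem hx _⟩ with hFdef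
  have hFB : ∀ j, ∀ x ∈ X, (F j).1 x = B j x := fun j x hx => indicator_of_mem hx _
  have hF0 : ∀ j, 2 * N + 1 ≤ j → F j = 0 := by
    intro j hj
    ext x
    simp [hFdef, hB0 j (by omega)]
  have hFsum : ∀ x ∈ X, ∀ v : ℂ, ‖v‖ = 1 →
      v ^ N * (Φ x v : ℂ) = ∑ j ∈ Finset.range (2 * N + 1), (F j).1 x * v ^ j := by
    intro x hx v hv
    rw [hΦa x (hXsub hx) v hv, hBsum x v hv]
    exact Finset.sum_congr rfl fun j _ => by rw [hFB j x hx]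
  have htr := fun x (hx : x ∈ X) => transport_coeff (M := 2 * N + 1)
    (D := fun j => (wirtinger hX (F j)).1 x) (E := fun j => (wirtingerBar hX (F j)).1 x)
    (C := fun j => Complex.I * β * ((j : ℂ) - N) * (F j).1 x)
    (fun j hj => by simp [hF0 j hj]) (fun j hj => by simp [hF0 j hj])
    (fun j hj => by simp [hF0 j hj]) (hρ.infinite_arrivalVelocities h hβ hβρ hx)
    (fun w hw => hΦ.transport hβ hX F hFsum hx hw)
  have hoff : ∀ (G : smoothFunctions X), ∀ x ∉ X, G.1 x = 0 := fun G => G.2.2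
  have hpoly : ∀ j, IsConjPolynomialOn X (F j).1 := by
    refine isConjPolynomialOn_of_transport hX hXc F (fun j => Complex.I * β * ((j : ℂ) - N)) hF0
      ?_ ?_ ?_
    · ext x
      by_cases hx : x ∈ X
      · exact (htr x hx).2.1
      · exact hoff _ x hx
    · ext x
      by_cases hx : x ∈ X
      · exact (htr x hx).2.2.1
      · exact hoff _ x hx
    · intro j
      ext x
      by_cases hx : x ∈ X
      · exact (htr x hx).2.2.2 j
      · exact hoff _ x hx
  choose p hp using hpoly
  have hfd : ∀ j, ∀ x ∈ X, (wirtinger hX (F j)).1 x = evalConj (MvPolynomial.pderiv 0 (p j)) x ∧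
      (wirtingerBar hX (F j)).1 x = evalConj (MvPolynomial.pderiv 1 (p j)) x := by
    intro j x hx
    have h1 : (F j).1 =ᶠ[𝓝 x] evalConj (p j) := by
      filter_upwards [hX.mem_nhds hx] with y hy using hp j y hy
    have h2 : ∀ v : ℂ, (wirtinger hX (F j)).1 x * v + (wirtingerBar hX (F j)).1 x *
        (starRingEnd ℂ) v = evalConj (MvPolynomial.pderiv 0 (p j)) x * v +
        evalConj (MvPolynomial.pderiv 1 (p j)) x * (starRingEnd ℂ) v := by
      intro v
      rw [← fderiv_eq_wirtinger hX (F j) hx, h1.fderiv_eq, fderiv_evalConj]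
    have e1 := h2 1
    have e2 := h2 Complex.I
    simp only [map_one, mul_one, Complex.conj_I] at e1 e2
    have hI := Complex.I_mul_I
    constructor
    · linear_combination (1 / 2 : ℂ) * e1 - (Complex.I / 2) * e2 +
        ((wirtinger hX (F j)).1 x - (wirtingerBar hX (F j)).1 x -
        evalConj (MvPolynomial.pderiv 0 (p j)) x +
        evalConj (MvPolynomial.pderiv 1 (p j)) x) / 2 * hI
    · linear_combination (1 / 2 : ℂ) * e1 + (Complex.I / 2) * e2 -
        ((wirtinger hX (F j)).1 x - (wirtingerBar hX (F j)).1 x -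
        evalConj (MvPolynomial.pderiv 0 (p j)) x +
        evalConj (MvPolynomial.pderiv 1 (p j)) x) / 2 * hI
  have hpeq : ∀ x w : ℂ, ∑ j ∈ Finset.range (2 * N + 1),
      (evalConj (MvPolynomial.pderiv 0 (p j)) x * w ^ (j + 2) +
      evalConj (MvPolynomial.pderiv 1 (p j)) x * w ^ j +
      (Complex.I * β * ((j : ℂ) - N) * evalConj (p j) x) * w ^ (j + 1)) = 0 := by
    intro x w
    set Q : MvPolynomial (Fin 2) ℂ := ∑ j ∈ Finset.range (2 * N + 1),
      (MvPolynomial.pderiv 0 (p j) * MvPolynomial.C (w ^ (j + 2)) +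
      MvPolynomial.pderiv 1 (p j) * MvPolynomial.C (w ^ j) +
      (MvPolynomial.C (Complex.I * β * ((j : ℂ) - N)) * p j) * MvPolynomial.C (w ^ (j + 1)))
    have hQ : ∀ y, evalConj Q y = ∑ j ∈ Finset.range (2 * N + 1),
      (evalConj (MvPolynomial.pderiv 0 (p j)) y * w ^ (j + 2) +
      evalConj (MvPolynomial.pderiv 1 (p j)) y * w ^ j +
      (Complex.I * β * ((j : ℂ) - N) * evalConj (p j) y) * w ^ (j + 1)) := by
      intro y
      simp only [Q, evalConj, map_sum, map_add, map_mul, MvPolynomial.eval_C]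
    have hQ0 : Q = 0 := by
      refine eq_zero_of_evalConj_eq_zero hX hXne fun y hy => ?_
      rw [hQ, ← (htr y hy).1 w]
      refine Finset.sum_congr rfl fun j _ => ?_
      rw [(hfd j y hy).1, (hfd j y hy).2, hp j y hy]
    rw [← hQ, hQ0]
    simp [evalConj]
  have hBp : ∀ j, EqOn (B j) (evalConj (p j)) (closedAnnulus γ β) := by
    intro j
    refine EqOn.of_subset_closure (s := X) (fun x hx => ?_) (hB j).continuousOn
      (contDiff_evalConj _).continuous.continuousOn hXsub ?_
    · rw [← hFB j x hx, hp j x hx]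
    · rw [closedAnnulus, hXdef, openAnnulus]
      have h1 : (univ : Set ℝ) ×ˢ Icc 0 (2 * larmorRadius β) =
          closure (univ ×ˢ Ioo 0 (2 * larmorRadius β)) := by
        rw [closure_prod_eq, closure_univ, closure_Ioo (by positivity)]
      rw [h1]
      exact image_closure_subset_closure_image h.contDiff_normalMap.continuous
  set r := larmorRadius β
  set S : MvPolynomial (Fin 2) ℂ →ₐ[ℂ] MvPolynomial (Fin 2) ℂ :=
    MvPolynomial.bind₁ ![MvPolynomial.X 0 - MvPolynomial.C (r * Complex.I),
      MvPolynomial.X 1 + MvPolynomial.C (r * Complex.I)] with hS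
  have hSeval : ∀ q c, evalConj (S q) c = evalConj q (c - r * Complex.I) := by
    intro q c
    rw [evalConj, evalConj, hS, MvPolynomial.bind₁, MvPolynomial.aeval_def,
      MvPolynomial.algebraMap_eq, ← MvPolynomial.coe_eval₂Hom, ← RingHom.comp_apply]
    congr 1
    apply MvPolynomial.ringHom_ext
    · intro c; simp
    · intro i
      fin_cases i
      · simp
      · simp
  refine ⟨∑ j ∈ Finset.range (2 * N + 1), S (p j), fun x hx v hv => ?_⟩
  have h1 := eq_eval_centre_of_transport hβ.ne' p hpeq (x + r * Complex.I * v) hv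
  rw [add_sub_cancel_right] at h1
  have h2 := hBsum x v hv
  rw [← hΦa x hx v hv] at h2
  have h3 : ∑ j ∈ Finset.range (2 * N + 1), B j x * v ^ j =
      ∑ j ∈ Finset.range (2 * N + 1), evalConj (p j) x * v ^ j :=
    Finset.sum_congr rfl fun j _ => by rw [hBp j hx]
  rw [h3, h1] at h2
  have hv0 : v ^ N ≠ 0 := pow_ne_zero _ (by rw [← norm_ne_zero_iff, hv]; exact one_ne_zero)
  rw [mul_left_cancel₀ hv0 h2]
  have h4 : evalConj (∑ j ∈ Finset.range (2 * N + 1), S (p j)) (x + r * Complex.I * v) =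
      ∑ j ∈ Finset.range (2 * N + 1), evalConj (S (p j)) (x + r * Complex.I * v) := by
    simp only [evalConj, map_sum]
  rw [h4]
  exact Finset.sum_congr rfl fun j _ => (hSeval _ _).symm

end

/-! ### Expansion of the reflection symmetry on Larmor circles -/

/-- If `Q = a₂ θ² + a₃ θ³ + ⋯` and `Qᵏ⁺¹ G` is even, then the coefficient of `θ²ᵏ⁺³` in the
latter vanishes; here `2 a₂ = Q''(0)` and `6 a₃ = Q'''(0)`. -/
theorem coeff_eq_zero_of_even {Q Q₁ Q₂ G : ℝ → ℂ} {Q₃ G₁ : ℂ} (hQ : AnalyticAt ℝ Q 0)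
    (h0 : Q 0 = 0) (h1 : Q₁ 0 = 0) (hd1 : ∀ θ, HasDerivAt Q (Q₁ θ) θ)
    (hd2 : ∀ θ, HasDerivAt Q₁ (Q₂ θ) θ) (hd3 : HasDerivAt Q₂ Q₃ 0) (hG : HasDerivAt G G₁ 0)
    (k : ℕ) (heven : ∀ θ, Q θ ^ (k + 1) * G θ = Q (-θ) ^ (k + 1) * G (-θ)) :
    (Q₂ 0 / 2) ^ k * ((k + 1) * (Q₃ / 6) * G 0 + (Q₂ 0 / 2) * G₁) = 0 := by
  obtain ⟨p, hp⟩ := hQ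
  -- `Q = θ² R` with `R` analytic, so that evenness passes to `R ^ (k + 1) * G`.
  set R := dslope (dslope Q 0) 0 with hR
  have hRan : AnalyticAt ℝ R 0 :=
    ⟨_, hp.has_fpower_series_dslope_fslope.has_fpower_series_dslope_fslope⟩
  have hS0 : dslope Q 0 0 = 0 := by rw [dslope_same, (hd1 0).deriv, h1]
  have hQR : ∀ θ, Q θ = (θ : ℂ) ^ 2 * R θ := by
    intro θ
    have e1 := sub_smul_dslope Q 0 θ
    have e2 := sub_smul_dslope (dslope Q 0) 0 θ
    rw [h0, sub_zero, sub_zero, Complex.real_smul] at e1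
    rw [hS0, sub_zero, sub_zero, Complex.real_smul] at e2
    rw [← e1, ← e2, hR]
    ring
  have hid : ∀ θ : ℝ, HasDerivAt (fun θ : ℝ => (θ : ℂ)) 1 θ := fun θ => by
    simpa using (hasDerivAt_id θ).ofReal_comp
  have hsq : ∀ θ : ℝ, HasDerivAt (fun θ : ℝ => (θ : ℂ) ^ 2) (2 * θ) θ := fun θ =>
    ((hid θ).pow 2).congr_deriv (by simp)
  have hR1an := hRan.deriv
  have hR2an := hR1an.deriv
  have hev : ∀ᶠ θ in 𝓝 (0 : ℝ), HasDerivAt R (deriv R θ) θ :=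
    hRan.eventually_analyticAt.mono fun θ h => h.differentiableAt.hasDerivAt
  have hev1 : ∀ᶠ θ in 𝓝 (0 : ℝ), HasDerivAt (deriv R) (deriv (deriv R) θ) θ :=
    hR1an.eventually_analyticAt.mono fun θ h => h.differentiableAt.hasDerivAt
  have hQ1 : ∀ᶠ θ in 𝓝 (0 : ℝ), Q₁ θ = 2 * θ * R θ + (θ : ℂ) ^ 2 * deriv R θ := by
    filter_upwards [hev] with θ hθ
    have : Q = fun θ : ℝ => (θ : ℂ) ^ 2 * R θ := funext hQR
    exact (hd1 θ).unique (this ▸ (hsq θ).mul hθ)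
  have hQ2 : ∀ᶠ θ in 𝓝 (0 : ℝ), Q₂ θ = 2 * R θ + 4 * θ * deriv R θ +
      (θ : ℂ) ^ 2 * deriv (deriv R) θ := by
    filter_upwards [hev, hev1, hQ1.eventually_nhds] with θ hθ hθ1 hQ1θ
    have e1 := ((((hid θ).const_mul 2).mul hθ).add ((hsq θ).mul hθ1)).congr_of_eventuallyEq hQ1θ
    rw [(hd2 θ).unique e1]
    ring
  have e2 : Q₂ 0 = 2 * R 0 := by simpa using hQ2.self_of_nhds
  have hR3 : HasDerivAt (deriv (deriv R)) (deriv (deriv (deriv R)) 0) 0 :=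
    hR2an.differentiableAt.hasDerivAt
  have e3 : Q₃ = 6 * deriv R 0 := by
    have e1 := (((hev.self_of_nhds.const_mul 2).add
      (((hid 0).const_mul 4).mul hev1.self_of_nhds)).add ((hsq 0).mul hR3)).congr_of_eventuallyEq
        hQ2
    rw [hd3.unique e1]
    simp
    ring
  set H : ℝ → ℂ := fun θ => R θ ^ (k + 1) * G θ with hH
  have hHeven : ∀ θ, H θ = H (-θ) := by
    intro θ
    by_cases hθ : θ = 0
    · simp [hθ]
    · have := heven θ
      rw [hQR θ, hQR (-θ), mul_pow, mul_pow] at this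
      push_cast at this
      rw [neg_sq, mul_assoc, mul_assoc] at this
      exact mul_left_cancel₀ (pow_ne_zero _ (pow_ne_zero _ (by exact_mod_cast hθ))) this
  have hHd : HasDerivAt H ((k + 1) * R 0 ^ k * deriv R 0 * G 0 + R 0 ^ (k + 1) * G₁) 0 := by
    have := (hev.self_of_nhds.pow (k + 1)).mul hG
    refine HasDerivAt.congr_deriv this ?_
    simp
  have hH0 : (k + 1) * R 0 ^ k * deriv R 0 * G 0 + R 0 ^ (k + 1) * G₁ = 0 := by
    have h2 := deriv_comp_neg H 0
    have h3 : (fun θ => H (-θ)) = H := funext fun θ => (hHeven θ).symm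
    rw [h3, neg_zero, hHd.deriv] at h2
    linear_combination (1 / 2 : ℂ) * h2
  rw [e2, e3]
  rw [pow_succ] at hH0
  linear_combination hH0

theorem analyticAt_eval_pair {f g : ℝ → ℂ} {t : ℝ} (hf : AnalyticAt ℝ f t)
    (hg : AnalyticAt ℝ g t) (p : MvPolynomial (Fin 2) ℂ) :
    AnalyticAt ℝ (fun t => MvPolynomial.eval ![f t, g t] p) t := by
  induction p using MvPolynomial.induction_on with
  | C a => simpa using analyticAt_const
  | add p q hp hq =>
    simp only [map_add]
    exact hp.add hq
  | mul_X p i hp =>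
    simp only [map_mul, MvPolynomial.eval_X]
    refine hp.mul ?_
    fin_cases i
    · exact hf
    · exact hg

/-- The rotated vector `e^{iθ} n`. -/
def rotate (n : ℂ) (θ : ℝ) : ℂ := Complex.exp (θ * Complex.I) * n

theorem rotate_zero (n : ℂ) : rotate n 0 = n := by simp [rotate]

theorem norm_rotate (n : ℂ) (θ : ℝ) : ‖rotate n θ‖ = ‖n‖ := by
  rw [rotate, norm_mul, Complex.norm_exp_ofReal_mul_I, one_mul]

theorem hasDerivAt_rotate (n : ℂ) (θ : ℝ) :
    HasDerivAt (rotate n) (Complex.I * rotate n θ) θ := by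
  have h1 : HasDerivAt (fun θ : ℝ => (θ : ℂ) * Complex.I) Complex.I θ := by
    simpa using ((hasDerivAt_id θ).ofReal_comp).mul_const Complex.I
  exact (h1.cexp.mul_const n).congr_deriv (by rw [rotate]; ring)

theorem hasDerivAt_conj {f : ℝ → ℂ} {f' : ℂ} {t : ℝ} (hf : HasDerivAt f f' t) :
    HasDerivAt (fun t => (starRingEnd ℂ) (f t)) ((starRingEnd ℂ) f') t :=
  Complex.conjCLE.hasFDerivAt.comp_hasDerivAt t hf

theorem hasDerivAt_conj_rotate (n : ℂ) (θ : ℝ) :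
    HasDerivAt (fun θ => (starRingEnd ℂ) (rotate n θ))
      (-Complex.I * (starRingEnd ℂ) (rotate n θ)) θ :=
  (hasDerivAt_conj (hasDerivAt_rotate n θ)).congr_deriv (by simp)

theorem analyticAt_rotate (n : ℂ) (θ : ℝ) : AnalyticAt ℝ (rotate n) θ := by
  have h1 : ContDiff ℝ ω (fun θ : ℝ => Complex.exp (θ * Complex.I)) :=
    Complex.contDiff_exp.comp (Complex.ofRealCLM.contDiff.mul contDiff_const)
  exact (h1.contDiffAt.analyticAt).mul analyticAt_const

theorem pderiv_comm {σ : Type*} (i j : σ) (p : MvPolynomial σ ℂ) :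
    MvPolynomial.pderiv i (MvPolynomial.pderiv j p) =
      MvPolynomial.pderiv j (MvPolynomial.pderiv i p) := by
  classical
  have h : ⁅MvPolynomial.pderiv (R := ℂ) i, MvPolynomial.pderiv j⁆ =
      (0 : Derivation ℂ (MvPolynomial σ ℂ) (MvPolynomial σ ℂ)) := by
    refine MvPolynomial.derivation_ext (R := ℂ) (A := MvPolynomial σ ℂ) fun k => ?_
    rw [Derivation.commutator_apply, MvPolynomial.pderiv_X, MvPolynomial.pderiv_X]
    simp only [Pi.single_apply]
    split_ifs <;> simp
  have := DFunLike.congr_fun h p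
  rwa [Derivation.commutator_apply, Derivation.zero_apply, sub_eq_zero] at this

/-- The derivative of a polynomial in `z` and `z̄` along the Larmor circle with centre `z`. -/
theorem hasDerivAt_evalConj_circle (q : MvPolynomial (Fin 2) ℂ) (z n : ℂ) (r θ : ℝ) :
    HasDerivAt (fun θ => evalConj q (z + r * rotate n θ))
      (r * Complex.I * (rotate n θ * evalConj (MvPolynomial.pderiv 0 q) (z + r * rotate n θ) -
        (starRingEnd ℂ) (rotate n θ) *
          evalConj (MvPolynomial.pderiv 1 q) (z + r * rotate n θ))) θ := by
  have h1 : HasDerivAt (fun θ => z + r * rotate n θ) _ θ :=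
    ((hasDerivAt_rotate n θ).const_mul (r : ℂ)).const_add z
  refine (hasDerivAt_eval_pair h1 (hasDerivAt_conj h1) q).congr_deriv ?_
  simp only [evalConj, map_mul, Complex.conj_ofReal, Complex.conj_I]
  ring

theorem analyticAt_evalConj_circle (q : MvPolynomial (Fin 2) ℂ) (z n : ℂ) (r θ : ℝ) :
    AnalyticAt ℝ (fun θ => evalConj q (z + r * rotate n θ)) θ := by
  have h1 : AnalyticAt ℝ (fun θ => z + r * rotate n θ) θ :=
    analyticAt_const.add (analyticAt_const.mul (analyticAt_rotate n θ))
  have h2 : AnalyticAt ℝ (fun θ => (starRingEnd ℂ) (z + r * rotate n θ)) θ :=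
    (Complex.conjCLE.toContinuousLinearMap.analyticAt _).comp h1
  exact analyticAt_eval_pair h1 h2 q

/-- The second derivative at `θ = 0` of `θ ↦ f (c + r e^{iθ} n)`, expressed by the derivatives of
`f` at `z = c + r n`; here `m` stands for the conjugate of `n`. -/
def circleSecond (r : ℝ) (f : MvPolynomial (Fin 2) ℂ) (z n m : ℂ) : ℂ :=
  -(r : ℂ) * (n * evalConj (MvPolynomial.pderiv 0 f) z + m * evalConj (MvPolynomial.pderiv 1 f) z)
    - (r : ℂ) ^ 2 * (n ^ 2 * evalConj (MvPolynomial.pderiv 0 (MvPolynomial.pderiv 0 f)) z -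
      2 * (n * m) * evalConj (MvPolynomial.pderiv 0 (MvPolynomial.pderiv 1 f)) z +
      m ^ 2 * evalConj (MvPolynomial.pderiv 1 (MvPolynomial.pderiv 1 f)) z)

/-- The derivative of `circleSecond` when the point and both direction arguments vary. -/
theorem hasDerivAt_circleSecond (q : MvPolynomial (Fin 2) ℂ) {a b : ℝ → ℂ} {z : ℝ → ℂ}
    {a' b' z' : ℂ} {t : ℝ} (ha : HasDerivAt a a' t) (hb : HasDerivAt b b' t)
    (hz : HasDerivAt z z' t) (r : ℝ) :
    HasDerivAt (fun t => circleSecond r q (z t) (a t) (b t))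
      (-(r : ℂ) * (a' * evalConj (MvPolynomial.pderiv 0 q) (z t) + a t *
        (evalConj (MvPolynomial.pderiv 0 (MvPolynomial.pderiv 0 q)) (z t) * z' +
          evalConj (MvPolynomial.pderiv 0 (MvPolynomial.pderiv 1 q)) (z t) * (starRingEnd ℂ) z') +
        (b' * evalConj (MvPolynomial.pderiv 1 q) (z t) + b t *
        (evalConj (MvPolynomial.pderiv 0 (MvPolynomial.pderiv 1 q)) (z t) * z' +
          evalConj (MvPolynomial.pderiv 1 (MvPolynomial.pderiv 1 q)) (z t) *
            (starRingEnd ℂ) z'))) -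
      (r : ℂ) ^ 2 * (2 * a t * a' *
        evalConj (MvPolynomial.pderiv 0 (MvPolynomial.pderiv 0 q)) (z t) + a t ^ 2 *
        (evalConj (MvPolynomial.pderiv 0 (MvPolynomial.pderiv 0 (MvPolynomial.pderiv 0 q))) (z t) *
          z' + evalConj (MvPolynomial.pderiv 0 (MvPolynomial.pderiv 0 (MvPolynomial.pderiv 1 q)))
            (z t) * (starRingEnd ℂ) z') -
        (2 * (a' * b t + a t * b') *
          evalConj (MvPolynomial.pderiv 0 (MvPolynomial.pderiv 1 q)) (z t) + 2 * (a t * b t) *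
        (evalConj (MvPolynomial.pderiv 0 (MvPolynomial.pderiv 0 (MvPolynomial.pderiv 1 q))) (z t) *
          z' + evalConj (MvPolynomial.pderiv 0 (MvPolynomial.pderiv 1 (MvPolynomial.pderiv 1 q)))
            (z t) * (starRingEnd ℂ) z')) +
        (2 * b t * b' *
          evalConj (MvPolynomial.pderiv 1 (MvPolynomial.pderiv 1 q)) (z t) + b t ^ 2 *
        (evalConj (MvPolynomial.pderiv 0 (MvPolynomial.pderiv 1 (MvPolynomial.pderiv 1 q))) (z t) *
          z' + evalConj (MvPolynomial.pderiv 1 (MvPolynomial.pderiv 1 (MvPolynomial.pderiv 1 q)))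
            (z t) * (starRingEnd ℂ) z')))) t := by
  have he : ∀ p : MvPolynomial (Fin 2) ℂ, HasDerivAt (fun t => evalConj p (z t))
      (evalConj (MvPolynomial.pderiv 0 p) (z t) * z' +
        evalConj (MvPolynomial.pderiv 1 p) (z t) * (starRingEnd ℂ) z') t := fun p =>
    hasDerivAt_eval_pair hz (hasDerivAt_conj hz) p
  have h0 := (ha.mul (he (MvPolynomial.pderiv 0 q))).add (hb.mul (he (MvPolynomial.pderiv 1 q)))
  have h1 := (((ha.pow 2).mul (he (MvPolynomial.pderiv 0 (MvPolynomial.pderiv 0 q)))).sub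
    (((ha.mul hb).const_mul 2).mul (he (MvPolynomial.pderiv 0 (MvPolynomial.pderiv 1 q))))).add
    ((hb.pow 2).mul (he (MvPolynomial.pderiv 1 (MvPolynomial.pderiv 1 q))))
  have h2 := (h0.const_mul (-(r : ℂ))).sub (h1.const_mul ((r : ℂ) ^ 2))
  have c1 := pderiv_comm 1 0 q
  have c2 := pderiv_comm 1 0 (MvPolynomial.pderiv 0 q)
  have c3 := pderiv_comm 1 0 (MvPolynomial.pderiv 1 q)
  refine HasDerivAt.congr_deriv h2 ?_
  rw [c2, c3, c1]
  simp only [Pi.mul_apply, Pi.pow_apply]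
  push_cast
  ring

/-! ### The conserved quantity along a parallel curve -/

section

variable {Ω : Set ℂ} {γ : ℝ → ℂ} {L : ℝ}

theorem IsTable.hasDerivAt_parallel (h : IsTable Ω γ L) (r s : ℝ) :
    HasDerivAt (fun s => γ s + r * normal γ s)
      (-Complex.I * ((1 - r * curvature γ s : ℝ) : ℂ) * normal γ s) s := by
  refine ((h.hasDerivAt s).add ((h.hasDerivAt_normal s).const_mul (r : ℂ))).congr_deriv ?_
  rw [deriv_eq_neg_I_mul_normal]
  push_cast
  ring

/-- The derivative of a polynomial along the parallel curve `γ + r n`. -/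
theorem IsTable.hasDerivAt_evalConj_parallel (h : IsTable Ω γ L) (r s : ℝ)
    (q : MvPolynomial (Fin 2) ℂ) :
    HasDerivAt (fun s => evalConj q (γ s + r * normal γ s))
      (-Complex.I * ((1 - r * curvature γ s : ℝ) : ℂ) *
        (normal γ s * evalConj (MvPolynomial.pderiv 0 q) (γ s + r * normal γ s) -
        (starRingEnd ℂ) (normal γ s) *
          evalConj (MvPolynomial.pderiv 1 q) (γ s + r * normal γ s))) s := by
  have h1 := h.hasDerivAt_parallel r s
  refine (hasDerivAt_eval_pair h1 (hasDerivAt_conj h1) q).congr_deriv ?_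
  simp only [evalConj, map_mul, Complex.conj_ofReal, Complex.conj_I, map_neg]
  ring

/-- The gradient of a polynomial vanishing on a parallel curve is normal to it. -/
theorem IsTable.tangent_evalConj_eq_zero (h : IsTable Ω γ L) {r : ℝ}
    (hlam : ∀ s, 1 - r * curvature γ s ≠ 0) {J : Set ℝ} (hJ : IsOpen J)
    {f : MvPolynomial (Fin 2) ℂ} (hf : ∀ s ∈ J, evalConj f (γ s + r * normal γ s) = 0) :
    ∀ s ∈ J, normal γ s * evalConj (MvPolynomial.pderiv 0 f) (γ s + r * normal γ s) -
      (starRingEnd ℂ) (normal γ s) *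
        evalConj (MvPolynomial.pderiv 1 f) (γ s + r * normal γ s) = 0 := by
  intro s hs
  have h1 := h.hasDerivAt_evalConj_parallel r s f
  have h2 : (fun s => evalConj f (γ s + r * normal γ s)) =ᶠ[𝓝 s] fun _ => 0 := by
    filter_upwards [hJ.mem_nhds hs] with u hu using hf u hu
  have h3 := h1.unique ((hasDerivAt_const s (0 : ℂ)).congr_of_eventuallyEq h2)
  refine (mul_eq_zero.1 h3).resolve_left ?_
  have : ((1 - r * curvature γ s : ℝ) : ℂ) ≠ 0 := by exact_mod_cast hlam s
  simp only [neg_mul, ne_eq, neg_eq_zero, mul_eq_zero, Complex.I_ne_zero, false_or]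
  exact this

/-- Differentiating `n f_z - n̄ f_z̄ = 0` along the parallel curve expresses the second derivatives
of `f` in `circleSecond` by the normal derivative. -/
theorem IsTable.lam_mul_circleSecond (h : IsTable Ω γ L) {r : ℝ}
    (hlam : ∀ s, 1 - r * curvature γ s ≠ 0) {J : Set ℝ} (hJ : IsOpen J)
    {f : MvPolynomial (Fin 2) ℂ} (hf : ∀ s ∈ J, evalConj f (γ s + r * normal γ s) = 0) :
    ∀ s ∈ J, ((1 - r * curvature γ s : ℝ) : ℂ) *
      circleSecond r f (γ s + r * normal γ s) (normal γ s) ((starRingEnd ℂ) (normal γ s)) =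
      -(r : ℂ) * (normal γ s * evalConj (MvPolynomial.pderiv 0 f) (γ s + r * normal γ s) +
      (starRingEnd ℂ) (normal γ s) *
        evalConj (MvPolynomial.pderiv 1 f) (γ s + r * normal γ s)) := by
  intro s hs
  have htan := h.tangent_evalConj_eq_zero hlam hJ hf
  have hn := h.hasDerivAt_normal s
  have h1 := (hn.mul (h.hasDerivAt_evalConj_parallel r s (MvPolynomial.pderiv 0 f))).sub
    ((hasDerivAt_conj hn).mul (h.hasDerivAt_evalConj_parallel r s (MvPolynomial.pderiv 1 f)))
  have h2 := h1.unique ((hasDerivAt_const s (0 : ℂ)).congr_of_eventuallyEq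
    (by filter_upwards [hJ.mem_nhds hs] with u hu using htan u hu))
  simp only [map_mul, Complex.conj_I, Complex.conj_ofReal] at h2
  rw [pderiv_comm 1 0 f] at h2
  rw [circleSecond]
  push_cast at h2 ⊢
  linear_combination (-(r : ℂ) ^ 2 * Complex.I) * h2 + (r : ℂ) ^ 2 * (
    (curvature γ s : ℂ) * (normal γ s * evalConj (MvPolynomial.pderiv 0 f) (γ s + r * normal γ s) +
      (starRingEnd ℂ) (normal γ s) *
        evalConj (MvPolynomial.pderiv 1 f) (γ s + r * normal γ s)) -
    (1 - r * curvature γ s) * (normal γ s ^ 2 * evalConj (MvPolynomial.pderiv 0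
      (MvPolynomial.pderiv 0 f)) (γ s + r * normal γ s) -
      2 * (normal γ s * (starRingEnd ℂ) (normal γ s)) *
        evalConj (MvPolynomial.pderiv 0 (MvPolynomial.pderiv 1 f)) (γ s + r * normal γ s) +
      (starRingEnd ℂ) (normal γ s) ^ 2 *
        evalConj (MvPolynomial.pderiv 1 (MvPolynomial.pderiv 1 f)) (γ s + r * normal γ s))) *
    Complex.I_mul_I

/-- `circleSecond` is the second derivative along the Larmor circle. -/
theorem hasDerivAt_circle_deriv (f : MvPolynomial (Fin 2) ℂ) (z n : ℂ) (r θ : ℝ) :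
    HasDerivAt (fun θ => r * Complex.I *
      (rotate n θ * evalConj (MvPolynomial.pderiv 0 f) (z + r * rotate n θ) -
        (starRingEnd ℂ) (rotate n θ) * evalConj (MvPolynomial.pderiv 1 f) (z + r * rotate n θ)))
      (circleSecond r f (z + r * rotate n θ) (rotate n θ) ((starRingEnd ℂ) (rotate n θ))) θ := by
  have h1 := (((hasDerivAt_rotate n θ).mul
    (hasDerivAt_evalConj_circle (MvPolynomial.pderiv 0 f) z n r θ)).sub
    ((hasDerivAt_conj_rotate n θ).mul
      (hasDerivAt_evalConj_circle (MvPolynomial.pderiv 1 f) z n r θ))).const_mul (r * Complex.I)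
  refine HasDerivAt.congr_deriv h1 ?_
  rw [circleSecond, pderiv_comm 1 0 f]
  set n' := rotate n θ
  set m' := (starRingEnd ℂ) (rotate n θ)
  linear_combination ((r : ℂ) * (n' * evalConj (MvPolynomial.pderiv 0 f) (z + r * n') +
    m' * evalConj (MvPolynomial.pderiv 1 f) (z + r * n')) + (r : ℂ) ^ 2 * (n' ^ 2 *
    evalConj (MvPolynomial.pderiv 0 (MvPolynomial.pderiv 0 f)) (z + r * n') - 2 * (n' * m') *
    evalConj (MvPolynomial.pderiv 0 (MvPolynomial.pderiv 1 f)) (z + r * n') + m' ^ 2 *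
    evalConj (MvPolynomial.pderiv 1 (MvPolynomial.pderiv 1 f)) (z + r * n'))) * Complex.I_mul_I

/-- If `f ^ (k + 1) * g` is symmetric with respect to the normal on all Larmor circles centred on
`γ`, and `f` vanishes on the parallel curve `γ + r n`, then this expression is constant along it.
Up to powers of `λ = 1 - r κ`, the factor `circleSecond` is the normal derivative of `f`. -/
theorem IsTable.hasDerivAt_conserved (h : IsTable Ω γ L) {r : ℝ} (hr : r ≠ 0)
    (hlam : ∀ s, 1 - r * curvature γ s ≠ 0) {J : Set ℝ} (hJ : IsOpen J)
    {f g : MvPolynomial (Fin 2) ℂ} (hf : ∀ s ∈ J, evalConj f (γ s + r * normal γ s) = 0) (k : ℕ)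
    (heven : ∀ s ∈ J, ∀ θ, evalConj f (γ s + r * rotate (normal γ s) θ) ^ (k + 1) *
        evalConj g (γ s + r * rotate (normal γ s) θ) =
      evalConj f (γ s + r * rotate (normal γ s) (-θ)) ^ (k + 1) *
        evalConj g (γ s + r * rotate (normal γ s) (-θ))) {s : ℝ} (hs : s ∈ J) :
    HasDerivAt (fun s => circleSecond r f (γ s + r * normal γ s) (normal γ s)
        ((starRingEnd ℂ) (normal γ s)) ^ (3 * k + 3) *
      ((1 - r * curvature γ s : ℝ) : ℂ) ^ (2 * k + 2) *
      evalConj g (γ s + r * normal γ s) ^ 3) 0 s := by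
  set lam : ℝ → ℂ := fun s => ((1 - r * curvature γ s : ℝ) : ℂ) with hlamdef
  set A : ℝ → ℂ := fun s => circleSecond r f (γ s + r * normal γ s) (normal γ s)
        ((starRingEnd ℂ) (normal γ s)) with hAdef
  set p : ℝ → ℂ := fun s => evalConj g (γ s + r * normal γ s) with hpdef
  have hn := h.hasDerivAt_normal s
  have hpar := h.hasDerivAt_parallel r s
  have htan := h.tangent_evalConj_eq_zero hlam hJ hf s hs
  have hlamA := h.lam_mul_circleSecond hlam hJ hf
  -- Derivatives along the parallel curve.
  have hA' := hasDerivAt_circleSecond f hn (hasDerivAt_conj hn) hpar r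
  obtain ⟨A', hA'eq⟩ : ∃ A', A' = deriv A s := ⟨_, rfl⟩
  have hAd : HasDerivAt A A' s := by rw [hA'eq]; exact hA'.differentiableAt.hasDerivAt
  have hAval := hAd.unique hA'
  obtain ⟨lam', hlam'⟩ : ∃ l, HasDerivAt lam l s := by
    have h1 : HasDerivAt (curvature γ) (deriv (curvature γ) s) s :=
      (h.contDiff_curvature.differentiable (by simp) s).hasDerivAt
    exact ⟨_, ((h1.const_mul r).const_sub 1).ofReal_comp⟩
  obtain ⟨p', hp'eq⟩ : ∃ p', p' = deriv p s := ⟨_, rfl⟩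
  have hp'' := h.hasDerivAt_evalConj_parallel r s g
  have hp' : HasDerivAt p p' s := by rw [hp'eq]; exact hp''.differentiableAt.hasDerivAt
  have hpval := hp'.unique hp''
  have hb : HasDerivAt (fun s => -(r : ℂ) *
      (normal γ s * evalConj (MvPolynomial.pderiv 0 f) (γ s + r * normal γ s) +
      (starRingEnd ℂ) (normal γ s) *
        evalConj (MvPolynomial.pderiv 1 f) (γ s + r * normal γ s))) _ s :=
    ((hn.mul (h.hasDerivAt_evalConj_parallel r s (MvPolynomial.pderiv 0 f))).add
      ((hasDerivAt_conj hn).mul (h.hasDerivAt_evalConj_parallel r s (MvPolynomial.pderiv 1 f)))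
        ).const_mul (-(r : ℂ))
  have hlamA' := (hlam'.mul hAd).unique (hb.congr_of_eventuallyEq
    (by filter_upwards [hJ.mem_nhds hs] with u hu using hlamA u hu))
  -- Derivatives along the Larmor circle.
  have hz0 : γ s + r * rotate (normal γ s) 0 = γ s + r * normal γ s := by rw [rotate_zero]
  have hcirc : HasDerivAt (fun θ => γ s + r * rotate (normal γ s) θ)
      (r * (Complex.I * rotate (normal γ s) 0)) 0 :=
    ((hasDerivAt_rotate (normal γ s) 0).const_mul (r : ℂ)).const_add (γ s)
  have hQ3 := hasDerivAt_circleSecond f (hasDerivAt_rotate (normal γ s) 0)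
    (hasDerivAt_conj_rotate (normal γ s) 0) hcirc r
  obtain ⟨Q₃, hQ₃eq⟩ : ∃ Q₃, Q₃ = deriv (fun θ => circleSecond r f
    (γ s + r * rotate (normal γ s) θ) (rotate (normal γ s) θ)
    ((starRingEnd ℂ) (rotate (normal γ s) θ))) 0 := ⟨_, rfl⟩
  have hQ3d : HasDerivAt (fun θ => circleSecond r f
    (γ s + r * rotate (normal γ s) θ) (rotate (normal γ s) θ)
    ((starRingEnd ℂ) (rotate (normal γ s) θ))) Q₃ 0 := by
      rw [hQ₃eq]; exact hQ3.differentiableAt.hasDerivAt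
  have hQ3val := hQ3d.unique hQ3
  have hG := hasDerivAt_evalConj_circle g (γ s) (normal γ s) r 0
  have hkey := coeff_eq_zero_of_even (analyticAt_evalConj_circle f (γ s) (normal γ s) r 0)
    (by rw [hz0]; exact hf s hs) (by rw [hz0, rotate_zero, htan, mul_zero])
    (hasDerivAt_evalConj_circle f (γ s) (normal γ s) r)
    (hasDerivAt_circle_deriv f (γ s) (normal γ s) r) hQ3d hG k (heven s hs)
  simp only [rotate_zero] at hkey hQ3val
  have hlamr : lam s = 1 - r * curvature γ s := by simp [hlamdef]
  have hlam0 : lam s ≠ 0 := by simp only [hlamdef]; exact_mod_cast hlam s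
  have hr0 : (r : ℂ) ≠ 0 := by exact_mod_cast hr
  simp only [map_mul, map_neg, Complex.conj_I, Complex.conj_ofReal] at hAval hlamA' hQ3val
  rw [pderiv_comm 1 0 f] at hlamA'
  -- The third derivative on the circle is determined by the second one along the curve.
  have hrel : lam s ^ 2 * Q₃ = -(r : ℂ) * (3 * lam s * A' + 2 * lam' * A s) := by
    have e : lam s ^ 2 * Q₃ + r * lam s * A' + 2 * r * (lam' * A s + lam s * A') = 0 := by
      rw [hlamA', hAval, hQ3val]
      have hl2 : ((1 - r * curvature γ s : ℝ) : ℂ) = lam s := rfl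
      rw [hl2]
      have hl3 : 1 - lam s - r * curvature γ s = 0 := by rw [hlamr]; ring
      linear_combination (-(r : ℂ) * Complex.I * lam s ^ 2 -
        r ^ 2 * Complex.I * curvature γ s * lam s - 2 * r ^ 2 * Complex.I * curvature γ s) * htan +
        (2 * Complex.I * r ^ 2 * lam s * (normal γ s ^ 2 *
          evalConj (MvPolynomial.pderiv 0 (MvPolynomial.pderiv 0 f)) (γ s + r * normal γ s) -
          (starRingEnd ℂ) (normal γ s) ^ 2 *
          evalConj (MvPolynomial.pderiv 1 (MvPolynomial.pderiv 1 f)) (γ s + r * normal γ s))) * hl3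
    linear_combination e
  have hkey2 : A s ^ k * ((k + 1) * Q₃ * p s + 3 * A s * (r * Complex.I *
      (normal γ s * evalConj (MvPolynomial.pderiv 0 g) (γ s + r * normal γ s) -
      (starRingEnd ℂ) (normal γ s) *
        evalConj (MvPolynomial.pderiv 1 g) (γ s + r * normal γ s)))) = 0 := by
    rw [div_pow, div_mul_eq_mul_div, div_eq_zero_iff] at hkey
    have h2 := hkey.resolve_right (pow_ne_zero _ two_ne_zero)
    simp only [hAdef, hpdef]
    linear_combination 6 * h2
  have hfin : A s ^ k * ((k + 1) * (3 * lam s * A' + 2 * lam' * A s) * p s +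
      3 * lam s * A s * p') = 0 := by
    have e : (r : ℂ) * (A s ^ k * ((k + 1) * (3 * lam s * A' + 2 * lam' * A s) * p s +
      3 * lam s * A s * p')) = 0 := by
      rw [hpval]
      have hl2 : ((1 - r * curvature γ s : ℝ) : ℂ) = lam s := rfl
      rw [hl2]
      linear_combination (-lam s ^ 2) * hkey2 + A s ^ k * (k + 1) * p s * hrel
    exact (mul_eq_zero.1 e).resolve_left hr0
  -- Up to a factor, `hfin` says that the logarithmic derivative of the product vanishes.
  have hW := ((hAd.pow (3 * k + 3)).mul (hlam'.pow (2 * k + 2))).mul (hp'.pow 3)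
  refine HasDerivAt.congr_deriv hW ?_
  have e1 : 3 * k + 3 - 1 = 2 * k + 2 + k := by omega
  have e2 : 2 * k + 2 - 1 = 2 * k + 1 := by omega
  simp only [Pi.pow_apply, Pi.mul_apply, e1, e2]
  push_cast
  have e3 : A s ^ (3 * k + 3) = A s ^ (2 * k + 2) * A s ^ k * A s := by ring
  have e4 : A s ^ (2 * k + 2 + k) = A s ^ (2 * k + 2) * A s ^ k := by ring
  rw [e3, e4]
  linear_combination (A s ^ (2 * k + 2) * lam s ^ (2 * k + 1) * p s ^ 2) * hfin

end

/-! ### Polynomial relations along a generic arc of the boundary -/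

/-- The data `(γ, γ̄, n, n̄, κ)` of the boundary curve at a parameter value. -/
def curveData (γ : ℝ → ℂ) (s : ℝ) : Fin 5 → ℂ :=
  ![γ s, (starRingEnd ℂ) (γ s), normal γ s, (starRingEnd ℂ) (normal γ s), (curvature γ s : ℂ)]

/-- The ideal of polynomial relations between `γ, γ̄, n, n̄, κ` on a set of parameters. -/
def curveIdeal (γ : ℝ → ℂ) (J : Set ℝ) : Ideal (MvPolynomial (Fin 5) ℂ) :=
  MvPolynomial.vanishingIdeal ℂ (curveData γ '' J)

theorem mem_curveIdeal {γ : ℝ → ℂ} {J : Set ℝ} {p : MvPolynomial (Fin 5) ℂ} :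
    p ∈ curveIdeal γ J ↔ ∀ s ∈ J, MvPolynomial.eval (curveData γ s) p = 0 := by
  simp [curveIdeal, MvPolynomial.mem_vanishingIdeal_iff, MvPolynomial.aeval_eq_eval]

theorem curveIdeal_anti {γ : ℝ → ℂ} {J J' : Set ℝ} (h : J' ⊆ J) :
    curveIdeal γ J ≤ curveIdeal γ J' := fun _ hp =>
  mem_curveIdeal.2 fun s hs => mem_curveIdeal.1 hp s (h hs)

variable {Ω : Set ℂ} {γ : ℝ → ℂ} {L : ℝ}

theorem IsTable.continuous_curveData (h : IsTable Ω γ L) : Continuous (curveData γ) := by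
  have h1 := h.smooth.continuous
  have h2 := h.contDiff_normal.continuous
  have h3 := h.contDiff_curvature.continuous
  refine continuous_pi fun i => ?_
  fin_cases i
  · exact h1
  · exact Complex.continuous_conj.comp h1
  · exact h2
  · exact Complex.continuous_conj.comp h2
  · exact Complex.continuous_ofReal.comp h3

/-- The ideals of relations on shrinking intervals increase, so they stabilize on a small enough
interval; the stable ideal is prime because a function that does not vanish identically has no
zeros on some subinterval. -/
theorem IsTable.exists_isPrime_curveIdeal (h : IsTable Ω γ L) {a₀ b₀ : ℝ} (hab : a₀ < b₀) :
    ∃ a b, a₀ ≤ a ∧ a < b ∧ b ≤ b₀ ∧ (curveIdeal γ (Ioo a b)).IsPrime := by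
  obtain ⟨_, ⟨a, b, ha, hlt, hb, rfl⟩, hmax⟩ := set_has_maximal_iff_noetherian.2
    (inferInstanceAs (IsNoetherian (MvPolynomial (Fin 5) ℂ) (MvPolynomial (Fin 5) ℂ)))
    {I : Ideal (MvPolynomial (Fin 5) ℂ) | ∃ a b, a₀ ≤ a ∧ a < b ∧ b ≤ b₀ ∧
      I = curveIdeal γ (Ioo a b)} ⟨_, a₀, b₀, le_rfl, hab, le_rfl, rfl⟩
  refine ⟨a, b, ha, hlt, hb, ?_, ?_⟩
  · intro htop
    have h1 : (1 : MvPolynomial (Fin 5) ℂ) ∈ curveIdeal γ (Ioo a b) := htop ▸ trivial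
    obtain ⟨s, hs⟩ := nonempty_Ioo.2 hlt
    simpa using mem_curveIdeal.1 h1 s hs
  · intro p q hpq
    rw [or_iff_not_imp_left]
    intro hp
    rw [mem_curveIdeal] at hp
    push Not at hp
    obtain ⟨s, hs, hps⟩ := hp
    have hcont : Continuous fun s => MvPolynomial.eval (curveData γ s) p :=
      (MvPolynomial.continuous_eval p).comp h.continuous_curveData
    have hev : ∀ᶠ u in 𝓝 s, MvPolynomial.eval (curveData γ u) p ≠ 0 ∧ u ∈ Ioo a b :=
      (hcont.continuousAt.eventually_ne hps).and (isOpen_Ioo.mem_nhds hs)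
    obtain ⟨a', b', hs', hsub⟩ := mem_nhds_iff_exists_Ioo_subset.1 hev
    have hlt' : a' < b' := hs'.1.trans hs'.2
    have hsub' : Ioo a' b' ⊆ Ioo a b := fun u hu => (hsub hu).2
    obtain ⟨haa, hbb⟩ := (Ioo_subset_Ioo_iff hlt').1 hsub'
    have hq : q ∈ curveIdeal γ (Ioo a' b') := mem_curveIdeal.2 fun u hu => by
      have := mem_curveIdeal.1 hpq u (hsub' hu)
      rw [map_mul] at this
      exact (mul_eq_zero.1 this).resolve_left (hsub hu).1
    have hle := curveIdeal_anti (γ := γ) hsub'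
    have heq : curveIdeal γ (Ioo a b) = curveIdeal γ (Ioo a' b') :=
      hle.eq_or_lt.resolve_right (hmax _ ⟨a', b', ha.trans haa, hlt', hbb.trans hb, rfl⟩)
    rwa [heq]

/-- Where the curvature is injective it is transcendental over `ℂ`, as a function on the curve. -/
theorem transcendental_curvature {a b : ℝ} (hab : a < b)
    (hκ : InjOn (curvature γ) (Ioo a b)) :
    Transcendental ℂ (Ideal.Quotient.mk (curveIdeal γ (Ioo a b)) (MvPolynomial.X 4)) := by
  rw [transcendental_iff]
  intro p hp
  have e : Polynomial.aeval (Ideal.Quotient.mk (curveIdeal γ (Ioo a b)) (MvPolynomial.X 4)) p =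
      Ideal.Quotient.mk (curveIdeal γ (Ioo a b)) (Polynomial.aeval (MvPolynomial.X 4) p) :=
    Polynomial.aeval_algHom_apply (Ideal.Quotient.mkₐ ℂ (curveIdeal γ (Ioo a b))) _ p
  rw [e, Ideal.Quotient.eq_zero_iff_mem, mem_curveIdeal] at hp
  refine Polynomial.eq_zero_of_infinite_isRoot p ?_
  have hinf : ((fun s => (curvature γ s : ℂ)) '' Ioo a b).Infinite :=
    (Ioo_infinite hab).image (Complex.ofReal_injective.comp_injOn hκ)
  refine hinf.mono ?_
  rintro _ ⟨s, hs, rfl⟩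
  have h1 := hp s hs
  have h2 := Polynomial.aeval_algHom_apply (MvPolynomial.aeval (R := ℂ) (curveData γ s))
    (MvPolynomial.X 4) p
  rw [MvPolynomial.aeval_X] at h2
  rw [MvPolynomial.aeval_eq_eval] at h2
  have h3 : Polynomial.aeval (curveData γ s 4) p = 0 := h2.trans h1
  rw [Polynomial.coe_aeval_eq_eval] at h3
  exact h3

/-! ### The equation of the parallel curve -/

section

variable {Ω : Set ℂ} {γ : ℝ → ℂ} {L : ℝ}

/-- Pull-back of polynomials in `z` and `z̄` to the parallel curve `z = γ + r n`. -/
def parallelLift (r : ℝ) : MvPolynomial (Fin 2) ℂ →ₐ[ℂ] MvPolynomial (Fin 5) ℂ :=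
  MvPolynomial.bind₁ ![MvPolynomial.X 0 + MvPolynomial.C (r : ℂ) * MvPolynomial.X 2,
    MvPolynomial.X 1 + MvPolynomial.C (r : ℂ) * MvPolynomial.X 3]

theorem eval_parallelLift (r s : ℝ) (q : MvPolynomial (Fin 2) ℂ) :
    MvPolynomial.eval (curveData γ s) (parallelLift r q) = evalConj q (γ s + r * normal γ s) := by
  rw [parallelLift, MvPolynomial.bind₁, evalConj, ← MvPolynomial.aeval_eq_eval,
    ← MvPolynomial.aeval_eq_eval]
  have : ((MvPolynomial.aeval (R := ℂ) (curveData γ s)).comp (MvPolynomial.aeval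
      ![MvPolynomial.X 0 + MvPolynomial.C (r : ℂ) * MvPolynomial.X 2,
        MvPolynomial.X 1 + MvPolynomial.C (r : ℂ) * MvPolynomial.X 3])) =
      MvPolynomial.aeval ![γ s + r * normal γ s, (starRingEnd ℂ) (γ s + r * normal γ s)] := by
    refine MvPolynomial.algHom_ext fun i => ?_
    fin_cases i <;> simp [curveData]
  exact DFunLike.congr_fun this q

/-- The ideal of polynomials in `z` and `z̄` that vanish on an arc of the parallel curve. -/
def parallelIdeal (γ : ℝ → ℂ) (J : Set ℝ) (r : ℝ) : Ideal (MvPolynomial (Fin 2) ℂ) :=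
  (curveIdeal γ J).comap (parallelLift r)

theorem mem_parallelIdeal {J : Set ℝ} {r : ℝ} {q : MvPolynomial (Fin 2) ℂ} :
    q ∈ parallelIdeal γ J r ↔ ∀ s ∈ J, evalConj q (γ s + r * normal γ s) = 0 := by
  simp [parallelIdeal, Ideal.mem_comap, mem_curveIdeal, eval_parallelLift]

/-- A regular arc of a parallel curve that lies on some algebraic curve is cut out by one
irreducible equation. -/
theorem IsTable.exists_prime_parallelIdeal_eq_span (h : IsTable Ω γ L) {r : ℝ}
    (hlam : ∀ s, 1 - r * curvature γ s ≠ 0) {a b : ℝ} (hab : a < b)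
    (hI : (curveIdeal γ (Ioo a b)).IsPrime) (h0 : parallelIdeal γ (Ioo a b) r ≠ ⊥) :
    ∃ f, Prime f ∧ parallelIdeal γ (Ioo a b) r = Ideal.span {f} := by
  have : (parallelIdeal γ (Ioo a b) r).IsPrime := Ideal.comap_isPrime _ _
  refine exists_prime_eq_span_singleton _ h0 fun x hx => ?_
  have hmem : MvPolynomial.X 0 - MvPolynomial.C (x 0) ∈ parallelIdeal γ (Ioo a b) r := by
    rw [hx, MvPolynomial.mem_vanishingIdeal_singleton_iff]; simp
  rw [mem_parallelIdeal] at hmem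
  obtain ⟨s, hs⟩ := nonempty_Ioo.2 hab
  have hev : (fun s => γ s + r * normal γ s) =ᶠ[𝓝 s] fun _ => x 0 := by
    filter_upwards [isOpen_Ioo.mem_nhds hs] with u hu
    simpa [evalConj, sub_eq_zero] using hmem u hu
  have h1 := (hasDerivAt_const s (x 0)).congr_of_eventuallyEq hev
  have h2 := h1.unique (h.hasDerivAt_parallel r s)
  have h3 : ((1 - r * curvature γ s : ℝ) : ℂ) ≠ 0 := by exact_mod_cast hlam s
  have h4 := normal_ne_zero h s
  simp only [neg_mul, zero_eq_neg, mul_eq_zero, Complex.I_ne_zero, false_or] at h2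
  exact h2.elim h3 h4

/-- `circleSecond` on the parallel curve as a polynomial in the curve data. -/
def circleSecondPoly (r : ℝ) (f : MvPolynomial (Fin 2) ℂ) : MvPolynomial (Fin 5) ℂ :=
  -MvPolynomial.C (r : ℂ) * (MvPolynomial.X 2 * parallelLift r (MvPolynomial.pderiv 0 f) +
      MvPolynomial.X 3 * parallelLift r (MvPolynomial.pderiv 1 f)) -
    MvPolynomial.C (r : ℂ) ^ 2 *
      (MvPolynomial.X 2 ^ 2 * parallelLift r (MvPolynomial.pderiv 0 (MvPolynomial.pderiv 0 f)) -
      2 * (MvPolynomial.X 2 * MvPolynomial.X 3) *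
        parallelLift r (MvPolynomial.pderiv 0 (MvPolynomial.pderiv 1 f)) +
      MvPolynomial.X 3 ^ 2 * parallelLift r (MvPolynomial.pderiv 1 (MvPolynomial.pderiv 1 f)))

theorem eval_circleSecondPoly (r s : ℝ) (f : MvPolynomial (Fin 2) ℂ) :
    MvPolynomial.eval (curveData γ s) (circleSecondPoly r f) =
      circleSecond r f (γ s + r * normal γ s) (normal γ s) ((starRingEnd ℂ) (normal γ s)) := by
  simp only [circleSecondPoly, circleSecond, map_sub, map_neg, map_mul, map_add, map_pow,
    MvPolynomial.eval_C, MvPolynomial.eval_X, map_ofNat, eval_parallelLift]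
  rfl

/-- An irreducible equation of the parallel curve has a nonzero differential on it, and so a
nonzero normal derivative. -/
theorem IsTable.circleSecondPoly_notMem (h : IsTable Ω γ L) {r : ℝ} (hr : r ≠ 0)
    (hlam : ∀ s, 1 - r * curvature γ s ≠ 0) {a b : ℝ} {f : MvPolynomial (Fin 2) ℂ}
    (hf : Prime f) (hspan : parallelIdeal γ (Ioo a b) r = Ideal.span {f}) :
    circleSecondPoly r f ∉ curveIdeal γ (Ioo a b) := by
  intro hmem
  have hf0 : ∀ s ∈ Ioo a b, evalConj f (γ s + r * normal γ s) = 0 := by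
    rw [← mem_parallelIdeal, hspan]; exact Ideal.mem_span_singleton_self f
  have hdvd : ∀ i, f ∣ MvPolynomial.pderiv i f := by
    intro i
    rw [← Ideal.mem_span_singleton, ← hspan, mem_parallelIdeal]
    intro s hs
    have h1 := h.tangent_evalConj_eq_zero hlam isOpen_Ioo hf0 s hs
    have h2 := h.lam_mul_circleSecond hlam isOpen_Ioo hf0 s hs
    rw [← eval_circleSecondPoly, mem_curveIdeal.1 hmem s hs, mul_zero] at h2
    have hr0 : (r : ℂ) ≠ 0 := by exact_mod_cast hr
    have h3 := (mul_eq_zero.1 h2.symm).resolve_left (neg_ne_zero.2 hr0)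
    have hn := normal_ne_zero h s
    have hn' : (starRingEnd ℂ) (normal γ s) ≠ 0 := by simpa using hn
    fin_cases i
    · refine (mul_eq_zero.1 (?_ : normal γ s * _ = 0)).resolve_left hn
      simp only [Fin.zero_eta]
      linear_combination (1 / 2 : ℂ) * h1 + (1 / 2 : ℂ) * h3
    · refine (mul_eq_zero.1 (?_ : (starRingEnd ℂ) (normal γ s) * _ = 0)).resolve_left hn'
      simp only [Fin.mk_one]
      linear_combination (1 / 2 : ℂ) * h3 - (1 / 2 : ℂ) * h1
  have hC := MvPolynomial.eq_C_of_pderiv_eq_zero fun i =>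
    MvPolynomial.pderiv_eq_zero_of_dvd (hdvd i)
  have hc0 : MvPolynomial.coeff 0 f ≠ 0 := by
    intro h0
    rw [h0, map_zero] at hC
    exact hf.ne_zero hC
  refine hf.not_isUnit ?_
  rw [hC]
  exact (isUnit_iff_ne_zero.2 hc0).map MvPolynomial.C

/-- A polynomial which is symmetric with respect to the normal on every Larmor circle centred on
`γ` is constant on the parallel curve `γ + r n`. -/
theorem IsTable.exists_evalConj_parallel_eq (h : IsTable Ω γ L) {r : ℝ} (hr : r ≠ 0)
    {P : MvPolynomial (Fin 2) ℂ} (hsym : ∀ s θ, evalConj P (γ s + r * rotate (normal γ s) θ) =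
      evalConj P (γ s + r * rotate (normal γ s) (-θ))) :
    ∃ c, ∀ s, evalConj P (γ s + r * normal γ s) = c := by
  have hr0 : (r : ℂ) ≠ 0 := by exact_mod_cast hr
  have htan : ∀ s, normal γ s * evalConj (MvPolynomial.pderiv 0 P) (γ s + r * normal γ s) -
      (starRingEnd ℂ) (normal γ s) *
        evalConj (MvPolynomial.pderiv 1 P) (γ s + r * normal γ s) = 0 := by
    intro s
    have h1 := hasDerivAt_evalConj_circle P (γ s) (normal γ s) r 0
    have h2 := deriv_comp_neg (fun θ => evalConj P (γ s + r * rotate (normal γ s) θ)) 0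
    have h3 : (fun θ => evalConj P (γ s + r * rotate (normal γ s) (-θ))) =
        fun θ => evalConj P (γ s + r * rotate (normal γ s) θ) := funext fun θ => (hsym s θ).symm
    rw [h3, neg_zero, h1.deriv] at h2
    simp only [rotate_zero] at h2
    have h4 := self_eq_neg.1 h2
    exact (mul_eq_zero.1 h4).resolve_left (mul_ne_zero hr0 Complex.I_ne_zero)
  have hd : ∀ s, HasDerivAt (fun s => evalConj P (γ s + r * normal γ s)) 0 s := fun s =>
    (h.hasDerivAt_evalConj_parallel r s P).congr_deriv (by rw [htan s, mul_zero])
  exact ⟨_, fun s => is_const_of_deriv_eq_zero (fun s => (hd s).differentiableAt)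
    (fun s => (hd s).deriv) s 0⟩

/-- The key step: a symmetric non-constant polynomial makes `κ - β` invertible in the coordinate
ring of the curve data, since the conserved quantity is a nonzero constant which `1 - r κ`
divides. -/
theorem IsTable.isUnit_curvature_sub (h : IsTable Ω γ L) {a b : ℝ} (hab : a < b)
    (hI : (curveIdeal γ (Ioo a b)).IsPrime) {β : ℝ} (hβ : 0 < β)
    (hlam : ∀ s, 1 - larmorRadius β * curvature γ s ≠ 0) {P : MvPolynomial (Fin 2) ℂ}
    (hP : ∀ c, P ≠ MvPolynomial.C c)
    (hsym : ∀ s θ, evalConj P (γ s + larmorRadius β * rotate (normal γ s) θ) =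
      evalConj P (γ s + larmorRadius β * rotate (normal γ s) (-θ))) :
    IsUnit (Ideal.Quotient.mk (curveIdeal γ (Ioo a b)) (MvPolynomial.X 4) -
      algebraMap ℂ (MvPolynomial (Fin 5) ℂ ⧸ curveIdeal γ (Ioo a b)) β) := by
  have hrβ := larmorRadius_mul hβ.ne'
  have hr := (larmorRadius_pos hβ).ne'
  set r := larmorRadius β
  obtain ⟨c, hc⟩ := h.exists_evalConj_parallel_eq hr hsym
  have hmem : P - MvPolynomial.C c ∈ parallelIdeal γ (Ioo a b) r :=
    mem_parallelIdeal.2 fun s _ => by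
      have := hc s
      simp only [evalConj] at this
      rw [evalConj, map_sub, MvPolynomial.eval_C, this, sub_self]
  have hP0 : P - MvPolynomial.C c ≠ 0 := sub_ne_zero.2 (hP c)
  obtain ⟨f, hfp, hspan⟩ := h.exists_prime_parallelIdeal_eq_span hlam hab hI fun hbot =>
    hP0 (by rwa [hbot, Ideal.mem_bot] at hmem)
  have hf0 : ∀ s ∈ Ioo a b, evalConj f (γ s + r * normal γ s) = 0 := by
    rw [← mem_parallelIdeal, hspan]; exact Ideal.mem_span_singleton_self f
  have hdvd : f ∣ P - MvPolynomial.C c := by rwa [hspan, Ideal.mem_span_singleton] at hmem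
  have hfin : FiniteMultiplicity f (P - MvPolynomial.C c) :=
    FiniteMultiplicity.of_prime_left hfp hP0
  obtain ⟨g, hg, hgf⟩ := hfin.exists_eq_pow_mul_and_not_dvd
  obtain ⟨k, hk⟩ : ∃ k, multiplicity f (P - MvPolynomial.C c) = k + 1 :=
    Nat.exists_eq_add_one_of_ne_zero (multiplicity_ne_zero.2 hdvd)
  rw [hk] at hg
  have hfg : ∀ z, evalConj f z ^ (k + 1) * evalConj g z = evalConj P z - c := by
    intro z
    have := congrArg (fun q => evalConj q z) hg
    simp only [evalConj, map_sub, map_mul, map_pow, MvPolynomial.eval_C] at this ⊢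
    exact this.symm
  have hcons := fun s hs => h.hasDerivAt_conserved (s := s) hr hlam isOpen_Ioo hf0 (g := g) k
    (fun s _ θ => by rw [hfg, hfg, hsym]) hs
  set lamPoly : MvPolynomial (Fin 5) ℂ := 1 - MvPolynomial.C (r : ℂ) * MvPolynomial.X 4
    with hlamPoly
  have hlamEval : ∀ s, MvPolynomial.eval (curveData γ s) lamPoly =
      ((1 - r * curvature γ s : ℝ) : ℂ) := fun s => by simp [hlamPoly, curveData]
  set W : MvPolynomial (Fin 5) ℂ := circleSecondPoly r f ^ (3 * k + 3) * lamPoly ^ (2 * k + 2) *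
    parallelLift r g ^ 3 with hW
  have hWeval : ∀ s ∈ Ioo a b, HasDerivAt (fun s => MvPolynomial.eval (curveData γ s) W) 0 s := by
    intro s hs
    convert hcons s hs using 2 with s
    simp only [hW, map_mul, map_pow, eval_circleSecondPoly, hlamEval, eval_parallelLift]
  obtain ⟨C₀, hC₀⟩ : ∃ C₀, ∀ s ∈ Ioo a b, MvPolynomial.eval (curveData γ s) W = C₀ :=
    isOpen_Ioo.exists_is_const_of_deriv_eq_zero isPreconnected_Ioo
      (fun s hs => (hWeval s hs).differentiableAt.differentiableWithinAt)
      (fun s hs => (hWeval s hs).deriv)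
  obtain ⟨s₀, hs₀⟩ := nonempty_Ioo.2 hab
  have hWmem : W ∉ curveIdeal γ (Ioo a b) := by
    intro hmem
    rcases hI.mem_or_mem hmem with h1 | h1
    · rcases hI.mem_or_mem h1 with h2 | h2
      · exact h.circleSecondPoly_notMem hr hlam hfp hspan (hI.mem_of_pow_mem _ h2)
      · have h3 := mem_curveIdeal.1 (hI.mem_of_pow_mem _ h2) s₀ hs₀
        rw [hlamEval] at h3
        exact hlam s₀ (by exact_mod_cast h3)
    · refine hgf ?_
      rw [← Ideal.mem_span_singleton, ← hspan]
      exact hI.mem_of_pow_mem _ h1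
  have hC₀0 : C₀ ≠ 0 := by
    rintro rfl
    exact hWmem (mem_curveIdeal.2 hC₀)
  have hWC : Ideal.Quotient.mk (curveIdeal γ (Ioo a b)) W =
      Ideal.Quotient.mk (curveIdeal γ (Ioo a b)) (MvPolynomial.C C₀) := by
    rw [Ideal.Quotient.eq, mem_curveIdeal]
    intro s hs
    simp [hC₀ s hs]
  have hWu : IsUnit (Ideal.Quotient.mk (curveIdeal γ (Ioo a b)) W) := by
    rw [hWC]
    exact ((isUnit_iff_ne_zero.2 hC₀0).map MvPolynomial.C).map _
  have hlamu : IsUnit (Ideal.Quotient.mk (curveIdeal γ (Ioo a b)) lamPoly) := by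
    refine isUnit_of_dvd_unit (map_dvd _ ?_) hWu
    exact (dvd_pow_self lamPoly (by omega)).trans ((dvd_mul_left _ _).trans (dvd_mul_right _ _))
  refine isUnit_of_dvd_unit ?_ hlamu
  refine ⟨Ideal.Quotient.mk _ (-MvPolynomial.C (r : ℂ)), ?_⟩
  rw [show algebraMap ℂ (MvPolynomial (Fin 5) ℂ ⧸ curveIdeal γ (Ioo a b)) β =
    Ideal.Quotient.mk _ (MvPolynomial.C (β : ℂ)) from rfl, ← map_sub, ← map_mul]
  congr 1
  have : MvPolynomial.C (σ := Fin 5) (r : ℂ) * MvPolynomial.C (β : ℂ) = 1 := by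
    rw [← map_mul, hrβ, map_one]
  rw [hlamPoly]
  linear_combination -this

end

section

variable {Ω : Set ℂ} {γ : ℝ → ℂ} {L : ℝ}

/-- A non-constant polynomial integral makes `κ - β` invertible in the coordinate ring of the curve
data. -/
theorem IsPolynomialIntegral.isUnit_curvature_sub (h : IsTable Ω γ L) {a b : ℝ} (hab : a < b)
    (hI : (curveIdeal γ (Ioo a b)).IsPrime) {β ρ : ℝ} (hβ : 0 < β) (hρ : IsTubularRadius γ L ρ)
    (hβρ : 2 * larmorRadius β < ρ) {Φ : ℂ → ℂ → ℝ} (hΦ : IsPolynomialIntegral Ω γ β Φ)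
    (hnc : ¬ IsConstantOnPhaseSpace γ β Φ) :
    IsUnit (Ideal.Quotient.mk (curveIdeal γ (Ioo a b)) (MvPolynomial.X 4) -
      algebraMap ℂ (MvPolynomial (Fin 5) ℂ ⧸ curveIdeal γ (Ioo a b)) β) := by
  have hr := larmorRadius_pos hβ
  obtain ⟨P, hP⟩ := hΦ.exists_centre_polynomial h hβ hρ hβρ
  refine h.isUnit_curvature_sub hab hI hβ
    (fun s => hρ.one_sub_mul_curvature_ne_zero h s ⟨by linarith, by linarith⟩) (P := P) ?_ ?_
  · rintro c rfl
    refine hnc ⟨c.re, fun x hx v hv => ?_⟩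
    have := hP x hx v hv
    rw [evalConj, MvPolynomial.eval_C] at this
    rw [← this, Complex.ofReal_re]
  · intro s θ
    have hmem : γ s ∈ closedAnnulus γ β :=
      ⟨(s, 0), ⟨mem_univ _, le_rfl, by linarith⟩, by simp [normalMap]⟩
    -- The velocity `-J e^{iθ} n` belongs to the Larmor centre `γ(s) + r e^{iθ} n`.
    have key : ∀ θ, (Φ (γ s) (-Complex.I * rotate (normal γ s) θ) : ℂ) =
        evalConj P (γ s + larmorRadius β * rotate (normal γ s) θ) := by
      intro θ
      rw [hP _ hmem _ (by rw [norm_mul, norm_rotate, h.norm_normal]; simp)]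
      congr 1
      linear_combination (-(larmorRadius β : ℂ) * rotate (normal γ s) θ) * Complex.I_mul_I
    have hrefl := hΦ.reflection s (-Complex.I * rotate (normal γ s) θ)
      (by rw [norm_mul, norm_rotate, h.norm_normal]; simp)
    have hv : -Complex.I * rotate (normal γ s) θ -
        (2 * inner ℝ (normal γ s) (-Complex.I * rotate (normal γ s) θ)) • normal γ s =
        -Complex.I * rotate (normal γ s) (-θ) := by
      have h1 : -Complex.I * rotate (normal γ s) θ * (starRingEnd ℂ) (normal γ s) =
          -Complex.I * Complex.exp (θ * Complex.I) := by
        rw [rotate]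
        linear_combination (-Complex.I * Complex.exp (θ * Complex.I)) *
          mul_conj_eq_one (h.norm_normal s)
      rw [inner_eq_re, h1, Complex.real_smul, rotate, rotate, Complex.ofReal_neg,
        Complex.exp_mul_I, Complex.exp_mul_I, Complex.cos_neg, Complex.sin_neg,
        ← Complex.ofReal_cos, ← Complex.ofReal_sin]
      have h2 : (-Complex.I * ((Real.cos θ : ℂ) + (Real.sin θ : ℂ) * Complex.I)).re =
          Real.sin θ := by
        rw [neg_mul, Complex.neg_re, Complex.I_mul_re]
        simpa using Complex.sin_ofReal_re θ
      rw [h2]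
      push_cast
      linear_combination (-2 * Complex.sin θ * normal γ s) * Complex.I_mul_I
    rw [hv] at hrefl
    rw [← key, ← key, hrefl]

/-! ### Domains with boundary of constant curvature -/

/-- A bounded domain whose boundary is a circle is a disc. -/
theorem IsTable.eq_ball_of_frontier (h : IsTable Ω γ L) {c : ℂ} {R : ℝ} (hR : 0 < R)
    (hfr : frontier Ω = Metric.sphere c R) : Ω = Metric.ball c R := by
  have hmeet : (Metric.ball c R ∩ Ω).Nonempty := by
    by_contra hemp
    rw [not_nonempty_iff_eq_empty] at hemp
    obtain ⟨p, hp⟩ := h.isConnected.nonempty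
    have hpd : R < dist p c := by
      rcases lt_trichotomy (dist p c) R with h1 | h1 | h1
      · have : p ∈ (∅ : Set ℂ) := hemp ▸ ⟨h1, hp⟩
        exact this.elim
      · have : p ∈ frontier Ω := hfr ▸ h1
        exact ((h.isOpen.frontier_eq ▸ this).2 hp).elim
      · exact h1
    -- The ray from `p` away from `c` would stay in the bounded set `Ω`.
    have hray : (fun t : ℝ => c + t • (p - c)) '' Ici 1 ⊆ Ω := by
      refine subset_of_isPreconnected_of_disjoint_frontier
        (isPreconnected_Ici.image _ (by fun_prop)) ?_ ⟨p, ⟨1, self_mem_Ici, by simp⟩, hp⟩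
      rw [Set.disjoint_left]
      rintro _ ⟨t, ht, rfl⟩ hx
      have ht' : (1 : ℝ) ≤ t := ht
      rw [hfr, mem_sphere_iff_norm, add_sub_cancel_left, norm_smul, Real.norm_eq_abs,
        abs_of_pos (by linarith), ← dist_eq_norm] at hx
      nlinarith
    obtain ⟨M, hM⟩ := h.isBounded.subset_ball c
    have hMpos : 0 < dist p c := hR.trans hpd
    have h1 := hM (hray ⟨max 1 (M / dist p c), mem_Ici.2 (le_max_left _ _), rfl⟩)
    have h2 : (0 : ℝ) < max 1 (M / dist p c) := lt_max_of_lt_left one_pos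
    rw [mem_ball_iff_norm, add_sub_cancel_left, norm_smul, Real.norm_eq_abs,
      abs_of_pos h2, ← dist_eq_norm] at h1
    have h3 : M / dist p c * dist p c ≤ max 1 (M / dist p c) * dist p c :=
      mul_le_mul_of_nonneg_right (le_max_right _ _) hMpos.le
    rw [div_mul_cancel₀ _ hMpos.ne'] at h3
    linarith
  apply Subset.antisymm
  · refine subset_of_isPreconnected_of_disjoint_frontier h.isConnected.isPreconnected ?_
      (by rwa [inter_comm])
    rw [frontier_ball _ hR.ne', ← hfr, h.isOpen.frontier_eq]
    exact disjoint_sdiff_right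
  · refine subset_of_isPreconnected_of_disjoint_frontier (convex_ball c R).isPreconnected ?_ hmeet
    rw [hfr]
    exact Metric.sphere_disjoint_ball.symm

/-- A table with boundary of constant curvature is a disc. A straight boundary is excluded, not
being closed; otherwise the centre of curvature `γ + n / k` is fixed. -/
theorem IsTable.exists_eq_ball_of_curvature_eq (h : IsTable Ω γ L) {k : ℝ}
    (hk : ∀ s, curvature γ s = k) : ∃ c R, Ω = Metric.ball c R := by
  have hk0 : k ≠ 0 := by
    rintro rfl
    have h1 : ∀ s, HasDerivAt (deriv γ) 0 s := fun s =>
      (h.hasDerivAt_deriv s).congr_deriv (by simp [hk s])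
    have h2 : ∀ s, deriv γ s = deriv γ 0 := fun s =>
      is_const_of_deriv_eq_zero (fun s => (h1 s).differentiableAt) (fun s => (h1 s).deriv) s 0
    have h3 : ∀ s, HasDerivAt (fun s => γ s - s * deriv γ 0) 0 s := fun s =>
      ((h.hasDerivAt s).sub ((hasDerivAt_id s).ofReal_comp.mul_const (deriv γ 0))).congr_deriv
        (by simp [h2 s])
    have h4 := is_const_of_deriv_eq_zero (fun s => (h3 s).differentiableAt)
      (fun s => (h3 s).deriv) L 0
    have h5 : γ L = γ 0 := by simpa using h.periodic 0
    have h6 : (L : ℂ) * deriv γ 0 = 0 := by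
      simp only [h5, Complex.ofReal_zero] at h4
      linear_combination -h4
    rcases mul_eq_zero.1 h6 with h7 | h7
    · exact h.length_pos.ne' (by exact_mod_cast h7)
    · have := h.unit_speed 0
      rw [h7] at this
      simp at this
  have hkC : (k : ℂ) ≠ 0 := by exact_mod_cast hk0
  obtain ⟨c, hc⟩ : ∃ c, ∀ s, γ s + (k : ℂ)⁻¹ * normal γ s = c := by
    have h1 : ∀ s, HasDerivAt (fun s => γ s + (k : ℂ)⁻¹ * normal γ s) 0 s := fun s =>
      ((h.hasDerivAt s).add ((h.hasDerivAt_normal s).const_mul (k : ℂ)⁻¹)).congr_deriv (by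
        rw [hk s, deriv_eq_neg_I_mul_normal]; field_simp; ring)
    exact ⟨_, fun s => is_const_of_deriv_eq_zero (fun s => (h1 s).differentiableAt)
      (fun s => (h1 s).deriv) s 0⟩
  have hn : ∀ s, normal γ s = rotate (normal γ 0) (k * s) := by
    have hexp : ∀ s : ℝ, HasDerivAt (fun s : ℝ => Complex.exp (-(k * s * Complex.I)))
        (-(k * Complex.I) * Complex.exp (-(k * s * Complex.I))) s := fun s => by
      have := ((((hasDerivAt_id s).ofReal_comp.const_mul (k : ℂ)).mul_const Complex.I).neg).cexp
      refine this.congr_deriv ?_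
      simp
      ring
    have h1 : ∀ s, HasDerivAt (fun s : ℝ => Complex.exp (-(k * s * Complex.I)) * normal γ s) 0 s :=
      fun s => ((hexp s).mul (h.hasDerivAt_normal s)).congr_deriv (by rw [hk s]; ring)
    intro s
    have h2 := is_const_of_deriv_eq_zero (fun s => (h1 s).differentiableAt)
      (fun s => (h1 s).deriv) s 0
    simp only [Complex.ofReal_zero, mul_zero, zero_mul, neg_zero, Complex.exp_zero, one_mul] at h2
    rw [rotate, ← h2, ← mul_assoc, ← Complex.exp_add]
    simp
  have hR : 0 < |k|⁻¹ := inv_pos.2 (abs_pos.2 hk0)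
  refine ⟨c, |k|⁻¹, h.eq_ball_of_frontier hR ?_⟩
  rw [h.frontier_eq]
  apply Subset.antisymm
  · rintro _ ⟨s, rfl⟩
    rw [mem_sphere_iff_norm, ← hc s, sub_add_cancel_left, norm_neg, norm_mul, h.norm_normal]
    simp
  · intro z hz
    rw [mem_sphere_iff_norm] at hz
    -- As the normal is `e^{iks} n(0)`, it attains the value `-k (z - c)`.
    set w := -(k : ℂ) * (z - c) * (starRingEnd ℂ) (normal γ 0) with hw
    have hwn : ‖w‖ = 1 := by
      rw [hw, norm_mul, norm_mul, hz, Complex.norm_conj, h.norm_normal, norm_neg,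
        Complex.norm_real, Real.norm_eq_abs, mul_one, mul_inv_cancel₀ (abs_pos.2 hk0).ne']
    refine ⟨k⁻¹ * w.arg, ?_⟩
    have h1 := hc (k⁻¹ * w.arg)
    have h2 : normal γ (k⁻¹ * w.arg) = -(k : ℂ) * (z - c) := by
      rw [hn, rotate, mul_inv_cancel_left₀ hk0]
      have h3 := Complex.norm_mul_exp_arg_mul_I w
      rw [hwn, Complex.ofReal_one, one_mul] at h3
      rw [h3, hw]
      linear_combination (-(k : ℂ) * (z - c)) * mul_conj_eq_one (h.norm_normal 0)
    rw [h2] at h1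
    rw [← sub_eq_zero, ← sub_eq_zero.2 h1]
    field_simp
    ring

/-- Unless the table is a disc, its curvature is injective on some interval. -/
theorem IsTable.exists_injOn_curvature (h : IsTable Ω γ L)
    (hnc : ¬ ∃ (c : ℂ) (R : ℝ), Ω = Metric.ball c R) :
    ∃ a b, a < b ∧ InjOn (curvature γ) (Ioo a b) := by
  obtain ⟨s, hs⟩ : ∃ s, deriv (curvature γ) s ≠ 0 := by
    by_contra! hall
    exact hnc (h.exists_eq_ball_of_curvature_eq fun s =>
      is_const_of_deriv_eq_zero (h.contDiff_curvature.differentiable (by simp)) hall s 0)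
  have hd : Continuous (deriv (curvature γ)) := h.contDiff_curvature.continuous_deriv (by simp)
  obtain ⟨a, b, hab, hsub⟩ := mem_nhds_iff_exists_Ioo_subset.1 (hd.continuousAt.eventually_ne hs)
  refine ⟨a, b, hab.1.trans hab.2, fun x hx y hy hxy => ?_⟩
  by_contra hne
  wlog hlt : x < y generalizing x y
  · exact this y hy x hx hxy.symm (Ne.symm hne) (lt_of_le_of_ne (not_lt.1 hlt) (Ne.symm hne))
  obtain ⟨t, ht, ht0⟩ := exists_deriv_eq_zero hlt h.contDiff_curvature.continuous.continuousOn hxy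
  exact hsub ⟨hx.1.trans ht.1, ht.2.trans hy.2⟩ ht0

end

end MagneticBilliard

end

theorem corollary1p2 (Ω : Set ℂ) (γ : ℝ → ℂ) (L : ℝ)
    (hΩ : MagneticBilliard.IsTable Ω γ L)
    (hnc : ¬ ∃ (c : ℂ) (R : ℝ), Ω = Metric.ball c R) :
    {β : ℝ | 0 < β ∧
      MagneticBilliard.larmorRadius β < MagneticBilliard.tubularRadius γ L / 2 ∧
      ∃ Φ : ℂ → ℂ → ℝ, MagneticBilliard.IsPolynomialIntegral Ω γ β Φ ∧
        ¬ MagneticBilliard.IsConstantOnPhaseSpace γ β Φ}.Finite := by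
  open MagneticBilliard in
  obtain ⟨a₀, b₀, hab₀, hinj⟩ := hΩ.exists_injOn_curvature hnc
  obtain ⟨a, b, ha, hab, hb, hI⟩ := hΩ.exists_isPrime_curveIdeal hab₀
  have hfin := finite_setOf_isUnit_sub_algebraMap _
    (transcendental_curvature hab (hinj.mono (Ioo_subset_Ioo ha hb)))
  refine (hfin.preimage (Complex.ofReal_injective.injOn)).subset ?_
  rintro β ⟨hβ, hβr, Φ, hΦ, hΦnc⟩
  obtain ⟨ρ, hβρ, hρ⟩ := exists_isTubularRadius_gt (γ := γ) (L := L) (R := 2 * larmorRadius β)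
    (by have := larmorRadius_pos hβ; linarith) (by linarith)
  exact hΦ.isUnit_curvature_sub hΩ hab hI hβ hρ hβρ hΦnc
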